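/- **Setting.** Let $K$ be a field, $a=(a_k)_{k\in\mathbb Z}$, $b=(b_k)_{k\in\mathbb Z}$ sequences in $K$, and $x=(x_1,\dots,x_n)$, $y=(y_1,\dots,y_n)\in K^n$ with $1-b_kx_i\ne0$ and $1+b_ky_i\neq 0$ for all $k,i$ (for instance independent indeterminates). Consider the six vertex model whose paths move right and down, with vertex weights $$\mathsf a_1=1-bx,\quad \mathsf a_2=y+a,\quad \mathsf b_1=1+by,\quad \mathsf b_2=x-a,\quad \mathsf c_1=1-ab,\quad \mathsf c_2=x+y,$$ where $\mathsf a_1$ is the empty vertex, $\mathsf a_2$ has all four edges occupied, $\mathsf b_1$ (resp. $\mathsf b_2$) is crossed by a vertical (resp. horizontal) path, $\mathsf c_1$ turns a path from the top to the right, and $\mathsf c_2$ turns a path from the left to the bottom. For a partition $\lambda$ let $|\lambda\rangle$ be the Maya diagram with occupied columns $\{\lambda_i-i+1: i\ge1\}$. Let $\mathcal A(x,y)$ be the operator on the span of the $|\lambda\rangle$ whose coefficient $\langle\mu|\mathcal A(x,y)|\lambda\rangle$ is the eventual value, as $N,M\to\infty$, of $$\frac{Z_{N,M}(\mu\to\lambda)}{\prod_{k=-N+1}^{0}(1+b_ky)\prod_{k=1}^M(1-b_kx)},$$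 where $Z_{N,M}(\mu\to\lambda)$ is the partition function of one row with columns $-N+1,\dots,M$, column $k$ having parameters $(a_k,b_k)$, top boundary $\mu$, bottom boundary $\lambda$, and empty left and right boundary edges. The free fermionic Schur functions are $$s_{\lambda/\mu;a,b}(x/y)=\langle\mu|\mathcal A(x_1,y_1)\cdots\mathcal A(x_n,y_n)|\lambda\rangle,\qquad s_{\lambda;a,b}=s_{\lambda/\emptyset;a,b}.$$ Write $(\tau^ra)_i=a_{i+r}$ and $\tau^r f_{a,b}=f_{\tau^ra,\tau^rb}$. For $d,e\geq 0$ put $$\widetilde s^{(d)}_{\lambda/\mu;a,b}=\prod_{i=1}^n\prod_{j=1}^d\frac{1+b_{1-j}y_i}{1-b_{1-j}x_i}\;s_{\lambda/\mu;a,b},\qquad \overline s^{(e)}_{\lambda/\mu;a,b}=\prod_{i=1}^n\prod_{j=1}^{e}\frac{1-b_{j}x_i}{1+b_{j}y_i}\;s_{\lambda/\mu;a,b}.$$ For $k\in\mathbb Z$ let $\widetilde h_k=\widetilde s^{(1)}_{(k);a,b}$, $\overline e_k=\overline s^{(1)}_{(1^k);a,b}$ and $e_k=s_{(1^k);a,b}$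 if $k\ge0$ (with $(0)=(1^0)=\emptyset$), and let all three be $0$ if $k<0$. **Theorem (determinant identities).** Let $\lambda$ be a partition with Frobenius coordinates $(\alpha_1,\dots,\alpha_r\,|\,\beta_1,\dots,\beta_r)$, that is, $r$ is the number of diagonal boxes, $\alpha_i=\lambda_i-i$, $\beta_i=\lambda_i'-i$. 1. (Jacobi–Trudi) For all $\mu\subseteq\lambda$ and $d\ge\ell(\lambda)$, $$\widetilde s^{(d)}_{\lambda/\mu;a,b}=\det\bigl(\tau^{\mu_j-j+1}\,\widetilde h_{\lambda_i-\mu_j-i+j}\bigr)_{1\le i,j\le d}.$$ 2. (Nägelsbach–Kostka) For all $\mu\subseteq\lambda$, $d\geq \ell(\lambda)$ and $e\ge\lambda_1$, $$\overline s^{(e)}_{\lambda/\mu;a,b}=\det\bigl(\tau^{-\mu_j'+j-1}\,\overline e_{\lambda_i'-\mu_j'-i+j}\bigr)_{1\le i,j\le e},$$ and, in terms of the same normalized functions as in part 1, $$\widetilde s^{(d)}_{\lambda/\mu;a,b}=\widetilde s^{(d)}_{\mu/\mu;a,b}\,\det\bigl(\tau^{-\mu_j'+j-1}\,e_{\lambda_i'-\mu_j'-i+j}\bigr)_{1\le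 i,j\le e}.$$ 3. (Giambelli) $s_{\lambda;a,b}=\det\bigl(s_{(\alpha_i|\beta_j);a,b}\bigr)_{1\le i,j\le r}$, where $(p|q)=(p+1,1^q)$. 4. (Ribbon formula) For $1\le i,j\le r$ let the ribbon $[\alpha_i|\beta_j]$ be the set of boxes on the rim of $\lambda$ (boxes $(p,q)\in\lambda$ with $(p+1,q+1)\notin\lambda$) whose contents $q-p$ lie between $-\beta_j$ and $\alpha_i$, and let $\kappa_{ij}=\lambda\setminus[\alpha_i|\beta_j]$, which is a partition. Every $s_{\kappa/\kappa;a,b}$ is nonzero, and with $s_{[\alpha_i|\beta_j];a,b}:=s_{\lambda/\kappa_{ij};a,b}/s_{\kappa_{ij}/\kappa_{ij};a,b}$, $$s_{\lambda;a,b}=\det\bigl(s_{[\alpha_i|\beta_j];a,b}\bigr)_{1\le i,j\le r}.$$ Equivalently, without normalization, $\det\bigl(s_{\lambda/\kappa_{ij};a,b}\bigr)_{1\le i,j\le r}=(s_{\lambda/\lambda;a,b})^{r-1}s_{\lambda;a,b}$. -/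

import Mathlib

open Finset

noncomputable section

namespace FFSchur

variable {K : Type*} [Field K]

/-! ### The six vertex model -/

/-- Boltzmann weight of a vertex with row parameters `x, y` and column parameters `a, b`. The four
Boolean arguments say whether the left, top, bottom and right edges are occupied. In the order of
the cases, the admissible types are `a₁, a₂, b₁, b₂, c₁, c₂`. -/
def vertexWeight (x y a b : K) : Bool → Bool → Bool → Bool → K
  | false, false, false, false => 1 - b * x
  | true, true, true, true => y + a
  | false, true, true, false => 1 + b * y
  | true, false, false, true => x - a
  | false, true, false, true => 1 - a * b
  | true, false, true, false => x + y
  | _, _, _, _ => 0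

/-- One column with top edge `t` and bottom edge `s`, as a matrix indexed by its left and right
edges. -/
def columnMatrix (x y a b : K) (t s : Bool) : Matrix Bool Bool K :=
  Matrix.of fun l r => vertexWeight x y a b l t s r

/-- The column labels `s + 1, s + 2, …, s + m`. -/
def columns (s : ℤ) (m : ℕ) : List ℤ := (List.range m).map fun k : ℕ => s + 1 + (k : ℤ)

/-- Coefficient `⟨v| M(x,y) |w⟩` of the monodromy matrix of a row with columns
`s + 1, …, s + m`; the tops of the columns are `v`, the bottoms are `w`. -/
def monodromy (a b : ℤ → K) (x y : K) (v w : ℤ → Bool) (s : ℤ) (m : ℕ) : Matrix Bool Bool K :=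
  ((columns s m).map fun k => columnMatrix x y (a k) (b k) (v k) (w k)).prod

/-- `⟨v| A(x,y; a^{N,M}, b^{N,M}) |w⟩`, the partition function of a row with columns
`-N + 1, …, M` and with unoccupied left and right boundary edges. -/
def rowCoeff (a b : ℤ → K) (x y : K) (v w : ℤ → Bool) (N M : ℕ) : K :=
  monodromy a b x y v w (-(N : ℤ)) (N + M) false false

/-- The dual sequence `a'_i = -a_{1-i}`. -/
def dualSeq (a : ℤ → K) : ℤ → K := fun i => -a (1 - i)

/-- The shifted power `(x; a)^k = (1 - a₁ x) ⋯ (1 - a_k x)`. -/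
def shiftedPow (x : K) (a : ℤ → K) (k : ℕ) : K := ∏ i ∈ range k, (1 - a ((i : ℤ) + 1) * x)

/-- The normalized row coefficient of a truncation of the infinite model. -/
def normRowCoeff (a b : ℤ → K) (x y : K) (v w : ℤ → Bool) (N M : ℕ) : K :=
  rowCoeff a b x y v w N M / (shiftedPow y (dualSeq b) N * shiftedPow x b M)

/-! ### Maya diagrams and the infinite row transfer operator -/

open Classical in
/-- The Maya diagram of a partition at level zero: the occupied positions are `λ_i - i + 1`,
`i = 1, 2, …` (here `i` starts from `0`). -/
def maya (lam : YoungDiagram) (k : ℤ) : Bool :=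
  decide (∃ i : ℕ, k = (lam.rowLen i : ℤ) - i)

/-- `⟨mu| 𝒜(x,y) |lam⟩`. The normalized coefficients of the truncations are eventually
constant (see `normRowCoeff_eq_coeffA`); this is the first truncation that contains all
columns where the two Maya diagrams differ from the vacuum. -/
def coeffA (a b : ℤ → K) (x y : K) (mu lam : YoungDiagram) : K :=
  normRowCoeff a b x y (maya mu) (maya lam)
    (max (mu.colLen 0) (lam.colLen 0)) (max (mu.rowLen 0) (lam.rowLen 0))

theorem maya_eq_true_iff (lam : YoungDiagram) (k : ℤ) :
    maya lam k = true ↔ ∃ i : ℕ, k = (lam.rowLen i : ℤ) - i := by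
  simp [maya]

theorem rowLen_eq_zero_of_le {lam : YoungDiagram} {i : ℕ} (h : lam.colLen 0 ≤ i) :
    lam.rowLen i = 0 := by
  by_contra hne
  have h1 : (i, 0) ∈ lam := YoungDiagram.mem_iff_lt_rowLen.2 (Nat.pos_of_ne_zero hne)
  have := YoungDiagram.mem_iff_lt_colLen.1 h1
  omega

theorem maya_left {lam : YoungDiagram} {N : ℕ} (h : lam.colLen 0 ≤ N) :
    maya lam (-(N : ℤ)) = true := by
  rw [maya_eq_true_iff]
  exact ⟨N, by simp [rowLen_eq_zero_of_le h]⟩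

theorem maya_right {lam : YoungDiagram} {M : ℕ} (h : lam.rowLen 0 ≤ M) :
    maya lam ((M : ℤ) + 1) = false := by
  rw [← Bool.not_eq_true, maya_eq_true_iff]
  rintro ⟨i, hi⟩
  have := lam.rowLen_anti 0 i (Nat.zero_le i)
  omega

theorem columns_add (s : ℤ) (m m' : ℕ) :
    columns s (m + m') = columns s m ++ columns (s + m) m' := by
  simp only [columns, List.range_add, List.map_append, List.map_map]
  congr 1
  apply List.map_congr_left
  intro k _
  simp only [Function.comp_apply, Nat.cast_add]
  ring

theorem monodromy_add (a b : ℤ → K) (x y : K) (v w : ℤ → Bool) (s : ℤ) (m m' : ℕ) :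
    monodromy a b x y v w s (m + m') =
      monodromy a b x y v w s m * monodromy a b x y v w (s + m) m' := by
  simp [monodromy, columns_add]

theorem monodromy_one (a b : ℤ → K) (x y : K) (v w : ℤ → Bool) (s : ℤ) :
    monodromy a b x y v w s 1 =
      columnMatrix x y (a (s + 1)) (b (s + 1)) (v (s + 1)) (w (s + 1)) := by
  simp [monodromy, columns]

theorem rowCoeff_succ_left (a b : ℤ → K) (x y : K) (v w : ℤ → Bool) (N M : ℕ)
    (hv : v (-(N : ℤ)) = true) (hw : w (-(N : ℤ)) = true) :
    rowCoeff a b x y v w (N + 1) M = (1 + b (-(N : ℤ)) * y) * rowCoeff a b x y v w N M := by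
  have h : N + 1 + M = 1 + (N + M) := by ring
  have e : (-((N + 1 : ℕ) : ℤ)) + 1 = -(N : ℤ) := by push_cast; ring
  rw [rowCoeff, h, monodromy_add, monodromy_one, Nat.cast_one, e, hv, hw]
  simp [Matrix.mul_apply, columnMatrix, vertexWeight, rowCoeff]

theorem rowCoeff_succ_right (a b : ℤ → K) (x y : K) (v w : ℤ → Bool) (N M : ℕ)
    (hv : v ((M : ℤ) + 1) = false) (hw : w ((M : ℤ) + 1) = false) :
    rowCoeff a b x y v w N (M + 1) = rowCoeff a b x y v w N M * (1 - b ((M : ℤ) + 1) * x) := by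
  have e : (-(N : ℤ)) + ((N + M : ℕ) : ℤ) + 1 = (M : ℤ) + 1 := by push_cast; ring
  rw [rowCoeff, ← add_assoc, monodromy_add, monodromy_one, e, hv, hw]
  simp [Matrix.mul_apply, columnMatrix, vertexWeight, rowCoeff]

/-- The normalized coefficients stabilize, and `coeffA` is their limit. -/
theorem normRowCoeff_eq_coeffA (a b : ℤ → K) (x y : K) (hx : ∀ k, 1 - b k * x ≠ 0)
    (hy : ∀ k, 1 + b k * y ≠ 0) (mu lam : YoungDiagram) (N M : ℕ)
    (hN : max (mu.colLen 0) (lam.colLen 0) ≤ N) (hM : max (mu.rowLen 0) (lam.rowLen 0) ≤ M) :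
    normRowCoeff a b x y (maya mu) (maya lam) N M = coeffA a b x y mu lam := by
  have key : ∀ N, max (mu.colLen 0) (lam.colLen 0) ≤ N →
      normRowCoeff a b x y (maya mu) (maya lam) N (max (mu.rowLen 0) (lam.rowLen 0)) =
        coeffA a b x y mu lam := by
    intro N hN
    induction N, hN using Nat.le_induction with
    | base => rfl
    | succ N hN ih =>
      rw [← ih, normRowCoeff, normRowCoeff,
        rowCoeff_succ_left _ _ _ _ _ _ _ _ (maya_left (le_trans (le_max_left _ _) hN))
          (maya_left (le_trans (le_max_right _ _) hN))]
      have e : shiftedPow y (dualSeq b) (N + 1) =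
          (1 + b (-(N : ℤ)) * y) * shiftedPow y (dualSeq b) N := by
        rw [shiftedPow, Finset.prod_range_succ, mul_comm]
        congr 1
        simp [dualSeq]
      rw [e, mul_assoc, mul_div_mul_left _ _ (hy _)]
  induction M, hM using Nat.le_induction with
  | base => exact key N hN
  | succ M hM ih =>
    rw [← ih, normRowCoeff, normRowCoeff,
      rowCoeff_succ_right _ _ _ _ _ _ _ _ (maya_right (le_trans (le_max_left _ _) hM))
        (maya_right (le_trans (le_max_right _ _) hM))]
    have e : shiftedPow x b (M + 1) = shiftedPow x b M * (1 - b ((M : ℤ) + 1) * x) := by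
      rw [shiftedPow, Finset.prod_range_succ, shiftedPow]
    rw [e, ← mul_assoc, mul_div_mul_right _ _ (hx _)]

theorem vertexWeight_ne_zero {x y a b : K} {l t s r : Bool}
    (h : vertexWeight x y a b l t s r ≠ 0) : t.toNat + l.toNat = s.toNat + r.toNat := by
  cases l <;> cases t <;> cases s <;> cases r <;> simp_all [vertexWeight]

/-- Paths are conserved along a row. -/
theorem monodromy_ne_zero {a b : ℤ → K} {x y : K} {v w : ℤ → Bool} {s : ℤ} {m : ℕ} {l r : Bool}
    (h : monodromy a b x y v w s m l r ≠ 0) :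
    (∑ k ∈ range m, (v (s + 1 + k)).toNat) + l.toNat =
      (∑ k ∈ range m, (w (s + 1 + k)).toNat) + r.toNat := by
  induction m generalizing r with
  | zero =>
    have : l = r := by
      by_contra hne
      apply h
      simp [monodromy, columns, hne]
    simp [this]
  | succ m ih =>
    rw [monodromy_add, Matrix.mul_apply] at h
    obtain ⟨c, -, hc⟩ := Finset.exists_ne_zero_of_sum_ne_zero h
    have h1 := ih (left_ne_zero_of_mul hc)
    have h2 := right_ne_zero_of_mul hc
    rw [monodromy_one] at h2
    have h3 := vertexWeight_ne_zero h2
    rw [Finset.sum_range_succ, Finset.sum_range_succ]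
    have e : s + (m : ℤ) + 1 = s + 1 + m := by ring
    rw [e] at h3
    omega

theorem sum_maya_eq_card (lam : YoungDiagram) (s : ℤ) (m : ℕ) :
    ∑ k ∈ range m, (maya lam (s + 1 + k)).toNat =
      ((range m).filter fun k : ℕ => maya lam (s + 1 + (k : ℤ)) = true).card := by
  rw [Finset.card_filter]
  apply Finset.sum_congr rfl
  intro k _
  cases maya lam (s + 1 + (k : ℤ)) <;> simp

/-- The coefficient `⟨mu| 𝒜(x,y) |lam⟩` vanishes unless `mu ⊆ lam`. -/
theorem le_of_coeffA_ne_zero {a b : ℤ → K} {x y : K} {mu lam : YoungDiagram}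
    (h : coeffA a b x y mu lam ≠ 0) : mu ≤ lam := by
  set N := max (mu.colLen 0) (lam.colLen 0) with hN
  set M := max (mu.rowLen 0) (lam.rowLen 0) with hM
  have h0 : rowCoeff a b x y (maya mu) (maya lam) N M ≠ 0 := by
    intro h1
    apply h
    rw [coeffA, normRowCoeff, ← hN, ← hM, h1, zero_div]
  have main : ∀ i : ℕ, mu.rowLen i ≤ lam.rowLen i := by
    intro i
    by_contra hlt
    push Not at hlt
    have hi : i < mu.colLen 0 := by
      by_contra hge
      have := rowLen_eq_zero_of_le (not_lt.1 hge)
      omega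
    have hiN : i < N := lt_of_lt_of_le hi (le_max_left _ _)
    have hlM : lam.rowLen i ≤ M :=
      le_trans (lam.rowLen_anti 0 i (Nat.zero_le i)) (le_max_right _ _)
    obtain ⟨m, hm⟩ : ∃ m : ℕ, (m : ℤ) = (lam.rowLen i : ℤ) - i + N :=
      ⟨lam.rowLen i + N - i, by omega⟩
    obtain ⟨m', hm'⟩ : ∃ m' : ℕ, N + M = m + m' := ⟨N + M - m, by omega⟩
    rw [rowCoeff, hm', monodromy_add, Matrix.mul_apply] at h0
    obtain ⟨c, -, hc⟩ := Finset.exists_ne_zero_of_sum_ne_zero h0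
    have h1 := monodromy_ne_zero (right_ne_zero_of_mul hc)
    have hs : -(N : ℤ) + m = (lam.rowLen i : ℤ) - i := by omega
    rw [hs, sum_maya_eq_card, sum_maya_eq_card] at h1
    have hA : i + 1 ≤ ((range m').filter fun k : ℕ =>
        maya mu ((lam.rowLen i : ℤ) - i + 1 + (k : ℤ)) = true).card := by
      have hsub : (range (i + 1)).image (fun j => mu.rowLen j + i - (lam.rowLen i + j + 1)) ⊆
          (range m').filter fun k : ℕ =>
            maya mu ((lam.rowLen i : ℤ) - i + 1 + (k : ℤ)) = true := by
        intro k hk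
        obtain ⟨j, hj, rfl⟩ := Finset.mem_image.1 hk
        have hji : j ≤ i := by simpa [Nat.lt_succ_iff] using hj
        have g1 := mu.rowLen_anti j i hji
        have g2 := mu.rowLen_anti 0 j (Nat.zero_le j)
        have g3 : mu.rowLen 0 ≤ M := le_max_left _ _
        rw [Finset.mem_filter, Finset.mem_range, maya_eq_true_iff]
        refine ⟨by omega, j, by omega⟩
      refine le_trans ?_ (Finset.card_le_card hsub)
      rw [Finset.card_image_of_injOn, Finset.card_range]
      intro j hj j' hj' hjj
      have hji : j ≤ i := by simpa [Nat.lt_succ_iff] using hj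
      have hji' : j' ≤ i := by simpa [Nat.lt_succ_iff] using hj'
      have g1 := mu.rowLen_anti j i hji
      have g2 := mu.rowLen_anti j' i hji'
      simp only at hjj
      rcases lt_trichotomy j j' with hl | hl | hl
      · have := mu.rowLen_anti j j' hl.le
        omega
      · exact hl
      · have := mu.rowLen_anti j' j hl.le
        omega
    have hB : ((range m').filter fun k : ℕ =>
        maya lam ((lam.rowLen i : ℤ) - i + 1 + (k : ℤ)) = true).card ≤ i := by
      have hsub : ((range m').filter fun k : ℕ =>
          maya lam ((lam.rowLen i : ℤ) - i + 1 + (k : ℤ)) = true) ⊆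
          (range i).image (fun j => lam.rowLen j + i - (lam.rowLen i + j + 1)) := by
        intro k hk
        rw [Finset.mem_filter, Finset.mem_range, maya_eq_true_iff] at hk
        obtain ⟨-, j, hj⟩ := hk
        have hji : j < i := by
          by_contra hge
          have := lam.rowLen_anti i j (not_lt.1 hge)
          omega
        exact Finset.mem_image.2 ⟨j, Finset.mem_range.2 hji, by omega⟩
      exact le_trans (Finset.card_le_card hsub)
        (le_trans Finset.card_image_le (by simp))
    simp only [Bool.toNat_false, add_zero] at h1
    omega
  rw [← YoungDiagram.cells_subset_iff]
  rintro ⟨i, j⟩ hc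
  rw [YoungDiagram.mem_cells, YoungDiagram.mem_iff_lt_rowLen] at hc ⊢
  exact lt_of_lt_of_le hc (main i)

theorem finite_support_coeffA (a b : ℤ → K) (x y : K) (lam : YoungDiagram) :
    (Function.support fun mu => coeffA a b x y mu lam).Finite := by
  apply Set.Finite.of_finite_image (f := YoungDiagram.cells)
  · apply Set.Finite.subset (lam.cells.powerset.finite_toSet)
    rintro _ ⟨mu, hmu, rfl⟩
    rw [Finset.mem_coe, Finset.mem_powerset, YoungDiagram.cells_subset_iff]
    exact le_of_coeffA_ne_zero hmu
  · intro mu _ nu _ h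
    exact YoungDiagram.ext h

/-- The infinite row transfer operator `𝒜_{a,b}(x,y)` on the level zero space, which has the
basis `|lam⟩`: it sends `|lam⟩` to `∑_mu ⟨mu| 𝒜_{a,b}(x,y) |lam⟩ |mu⟩`. -/
def opA (a b : ℤ → K) (x y : K) : Module.End K (YoungDiagram →₀ K) :=
  Finsupp.linearCombination K fun lam =>
    Finsupp.ofSupportFinite (fun mu => coeffA a b x y mu lam) (finite_support_coeffA a b x y lam)

/-! ### Free fermionic Schur functions -/

/-- The free fermionic Schur function
`s_{lam/mu; a,b}(x/y) = ⟨mu| 𝒜(x₁,y₁) ⋯ 𝒜(x_n,y_n) |lam⟩`. -/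
def schur (a b : ℤ → K) {n : ℕ} (x y : Fin n → K) (lam mu : YoungDiagram) : K :=
  ((List.ofFn fun i => opA a b (x i) (y i)).prod (Finsupp.single lam 1)) mu

/-- The shift `(τ^r a)_i = a_{i+r}`. -/
def shift (r : ℤ) (a : ℤ → K) : ℤ → K := fun i => a (i + r)

/-- The row normalization with `d` rows:
`∏_{i=1}^n ∏_{j=1}^d (1 + b_{1-j} y_i) / (1 - b_{1-j} x_i) · s_{lam/mu; a,b}(x/y)`. -/
def rowNormSchur (d : ℕ) (a b : ℤ → K) {n : ℕ} (x y : Fin n → K) (lam mu : YoungDiagram) : K :=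
  (∏ i, ∏ j ∈ range d, (1 + b (-(j : ℤ)) * y i) / (1 - b (-(j : ℤ)) * x i)) * schur a b x y lam mu

/-- The column normalization with `e` columns:
`∏_{i=1}^n ∏_{j=1}^e (1 - b_j x_i) / (1 + b_j y_i) · s_{lam/mu; a,b}(x/y)`. -/
def colNormSchur (e : ℕ) (a b : ℤ → K) {n : ℕ} (x y : Fin n → K) (lam mu : YoungDiagram) : K :=
  (∏ i, ∏ j ∈ range e, (1 - b ((j : ℤ) + 1) * x i) / (1 + b ((j : ℤ) + 1) * y i)) *
    schur a b x y lam mu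

/-- The one-row partition `(k)`; it is empty for `k = 0`. -/
def rowDiagram (k : ℕ) : YoungDiagram where
  cells := {0} ×ˢ range k
  isLowerSet := by
    rintro ⟨r, c⟩ ⟨r', c'⟩ ⟨h1, h2⟩ h
    simp only [coe_product, coe_singleton, coe_range, Set.mem_prod, Set.mem_singleton_iff,
      Set.mem_Iio] at h h1 h2 ⊢
    omega

/-- The one-column partition `(1^k)`; it is empty for `k = 0`. -/
def colDiagram (k : ℕ) : YoungDiagram := (rowDiagram k).transpose

/-- The hook `(p | q) = (p + 1, 1^q)`. -/
def hookDiagram (p q : ℕ) : YoungDiagram := rowDiagram (p + 1) ⊔ colDiagram (q + 1)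

/-- The row normalized function of the one-row partition `(k)`, with one row; it is zero for
`k < 0`. -/
def rowH (a b : ℤ → K) {n : ℕ} (x y : Fin n → K) (k : ℤ) : K :=
  if 0 ≤ k then rowNormSchur 1 a b x y (rowDiagram k.toNat) ⊥ else 0

/-- The column normalized function of the one-column partition `(1^k)`, with one column; it is
zero for `k < 0`. -/
def colE (a b : ℤ → K) {n : ℕ} (x y : Fin n → K) (k : ℤ) : K :=
  if 0 ≤ k then colNormSchur 1 a b x y (colDiagram k.toNat) ⊥ else 0

/-- The function `s_{(1^k); a,b}` without normalization; it is zero for `k < 0`. -/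
def schurE (a b : ℤ → K) {n : ℕ} (x y : Fin n → K) (k : ℤ) : K :=
  if 0 ≤ k then schur a b x y (colDiagram k.toNat) ⊥ else 0

/-- The number of boxes on the main diagonal. -/
def diagLen (lam : YoungDiagram) : ℕ := (lam.cells.filter fun c => c.1 = c.2).card

/-- The Frobenius coordinate `α_i = λ_i - i` (here `i` starts from `0`). -/
def arm (lam : YoungDiagram) (i : ℕ) : ℕ := lam.rowLen i - (i + 1)

/-- The Frobenius coordinate `β_j = λ'_j - j` (here `j` starts from `0`). -/
def leg (lam : YoungDiagram) (j : ℕ) : ℕ := lam.colLen j - (j + 1)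

/-- The partition that is left when the rim boxes weakly below row `i` and weakly to the right of
column `j` are removed from `lam`. For `i, j < diagLen lam` the removed ribbon consists of
the rim boxes with contents from `-β_j` to `α_i` (see `mem_ribbon_iff`). -/
def ribbonCore (lam : YoungDiagram) (i j : ℕ) : YoungDiagram where
  cells := lam.cells.filter fun c => (i ≤ c.1 ∧ j ≤ c.2) → (c.1 + 1, c.2 + 1) ∈ lam
  isLowerSet := by
    rintro ⟨r, c⟩ ⟨r', c'⟩ ⟨h1, h2⟩ h
    simp only [coe_filter, Set.mem_ofPred_eq, YoungDiagram.mem_cells] at h h1 h2 ⊢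
    refine ⟨lam.up_left_mem h1 h2 h.1, fun hij => ?_⟩
    exact lam.up_left_mem (by omega) (by omega) (h.2 ⟨by omega, by omega⟩)

theorem mem_diag_iff (lam : YoungDiagram) (i : ℕ) : (i, i) ∈ lam ↔ i < diagLen lam := by
  have hex : ∃ m, (m, m) ∉ lam := by
    refine ⟨lam.colLen 0, fun h => ?_⟩
    have := YoungDiagram.mem_iff_lt_colLen.1 (lam.up_left_mem le_rfl (Nat.zero_le _) h)
    omega
  classical
  have hspec := Nat.find_spec hex
  have hmin : ∀ i, (i, i) ∈ lam ↔ i < Nat.find hex := by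
    intro i
    constructor
    · intro h
      by_contra hge
      exact hspec (lam.up_left_mem (not_lt.1 hge) (not_lt.1 hge) h)
    · intro h
      by_contra hn
      exact Nat.find_min hex h hn
  have hcard : diagLen lam = Nat.find hex := by
    have e : (lam.cells.filter fun c => c.1 = c.2) =
        (range (Nat.find hex)).image fun i => (i, i) := by
      ext ⟨r, c⟩
      simp only [Finset.mem_filter, YoungDiagram.mem_cells, Finset.mem_image, Finset.mem_range,
        Prod.mk.injEq]
      constructor
      · rintro ⟨h, rfl⟩
        exact ⟨r, (hmin r).1 h, rfl, rfl⟩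
      · rintro ⟨i, hi, rfl, rfl⟩
        exact ⟨(hmin i).2 hi, rfl⟩
    rw [diagLen, e, Finset.card_image_of_injective _ (fun i j h => (Prod.mk.inj h).1),
      Finset.card_range]
  rw [hcard, hmin]

/-- The ribbon `[α_i | β_j]` of `lam`: the rim boxes with contents from `-β_j` to `α_i`. -/
theorem mem_ribbon_iff (lam : YoungDiagram) {i j : ℕ} (hi : i < diagLen lam)
    (hj : j < diagLen lam) (r c : ℕ) :
    ((r, c) ∈ lam ∧ (r, c) ∉ ribbonCore lam i j) ↔
      ((r, c) ∈ lam ∧ (r + 1, c + 1) ∉ lam ∧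
        -(leg lam j : ℤ) ≤ (c : ℤ) - r ∧ (c : ℤ) - r ≤ arm lam i) := by
  have hi1 := YoungDiagram.mem_iff_lt_rowLen.1 ((mem_diag_iff lam i).2 hi)
  have hj1 := YoungDiagram.mem_iff_lt_colLen.1 ((mem_diag_iff lam j).2 hj)
  have hcore : (r, c) ∈ ribbonCore lam i j ↔
      (r, c) ∈ lam ∧ ((i ≤ r ∧ j ≤ c) → (r + 1, c + 1) ∈ lam) := by
    rw [← YoungDiagram.mem_cells]
    simp [ribbonCore]
  rw [hcore, arm, leg]
  constructor
  · rintro ⟨h, h2⟩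
    have h3 : (i ≤ r ∧ j ≤ c) ∧ (r + 1, c + 1) ∉ lam := by
      by_contra hne
      exact h2 ⟨h, fun hij => by_contra fun hn => hne ⟨hij, hn⟩⟩
    have a1 := YoungDiagram.mem_iff_lt_rowLen.1 (lam.up_left_mem h3.1.1 le_rfl h)
    have a2 := YoungDiagram.mem_iff_lt_colLen.1 (lam.up_left_mem le_rfl h3.1.2 h)
    refine ⟨h, h3.2, by omega, by omega⟩
  · rintro ⟨h, h2, h3, h4⟩
    refine ⟨h, fun h5 => h2 (h5.2 ⟨?_, ?_⟩)⟩
    · by_contra hlt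
      have : (i, lam.rowLen i - 1) ∈ lam := YoungDiagram.mem_iff_lt_rowLen.2 (by omega)
      exact h2 (lam.up_left_mem (by omega) (by omega) this)
    · by_contra hlt
      have : (lam.colLen j - 1, j) ∈ lam := YoungDiagram.mem_iff_lt_colLen.2 (by omega)
      exact h2 (lam.up_left_mem (by omega) (by omega) this)

/-- The function of the ribbon `[α_i | β_j]`, seen as the skew shape `lam/kappa` with
`kappa = ribbonCore lam i j`, normalized so that the empty skew shape `kappa/kappa` has
the value `1`. -/
def ribbonSchur (a b : ℤ → K) {n : ℕ} (x y : Fin n → K) (lam : YoungDiagram) (i j : ℕ) : K :=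
  schur a b x y lam (ribbonCore lam i j) /
    schur a b x y (ribbonCore lam i j) (ribbonCore lam i j)

end FFSchur

end

noncomputable section

namespace FFSchur

variable {K : Type*} [Field K]

/-! ### Determinants -/

section LinearAlgebra

/-! The weights satisfy `a1 * a2 + b1 * b2 = c1 * c2`, so a row of the model is free fermionic:
divided by the weight of the empty row, its partition function is the determinant of the amplitudes
of single paths (`monodromy_eq_det_aux`). Paths only move right, so these amplitudes form a
triangular matrix over ℤ, an element of the incidence algebra. The vacuum fills the columns `≤ 0`,
and passing from the normalization by the vacuum to that by the empty row costs exactly the factor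
in the row normalization (`coeffA_eq_minor`). By Cauchy–Binet, composing rows multiplies these
matrices, so a row normalized skew function is a minor of one matrix `rowKernel`
(`rowNormSchur_eq_minor`).

Translating the matrix amounts to shifting `a` and `b`, and its row 0 consists of the one-row
functions; this is Jacobi–Trudi. Read from right to left, the holes form a free fermionic model too,
and complementing and reversing a Maya diagram transposes the partition; this gives
Nägelsbach–Kostka. In its second form, the normalizing factors of the matrix columns are eliminated
by comparison with the shape `mu/mu`.

Giambelli and the ribbon formula are two instances of `det_mul_pow_of_columns`. If `B` differs from
an invertible `A` in `r` columns, then `det (A⁻¹ * B)` is an `r × r` minor, whose entries are, by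
Cramer's rule, quotients of determinants with one column replaced. Starting from the vacuum and
moving one particle produces a hook; starting from `lam` and moving a diagonal particle into the
hole of a leg removes a ribbon. The sorting signs factor over the rows and columns of the outer
determinant and cancel. -/

theorem exists_perm_comp {d : ℕ} {ι : Type*} {J J' : Fin d → ι} (hJ' : Function.Injective J')
    (h : ∀ q, ∃ c, J' q = J c) : ∃ σ : Equiv.Perm (Fin d), J' = J ∘ σ := by
  choose f hf using h
  have hinj : Function.Injective f := fun p q hpq => hJ' (by rw [hf, hf, hpq])
  exact ⟨Equiv.ofBijective f (Finite.injective_iff_bijective.1 hinj), funext hf⟩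

theorem exists_perm_strictAnti {d : ℕ} {ι : Type*} [LinearOrder ι] {f : Fin d → ι}
    (hf : Function.Injective f) : ∃ σ : Equiv.Perm (Fin d), StrictAnti (f ∘ σ) := by
  refine ⟨Tuple.sort (fun i => OrderDual.toDual (f i)), ?_⟩
  have h := Tuple.monotone_sort (fun i => OrderDual.toDual (f i))
  have h2 : StrictMono ((fun i => OrderDual.toDual (f i)) ∘
      Tuple.sort (fun i => OrderDual.toDual (f i))) :=
    h.strictMono_of_injective
      ((OrderDual.toDual.injective.comp hf).comp (Equiv.injective _))
  exact fun i j hij => h2 hij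

/-- Sorting is unique because a decreasing tuple is determined by its range. In Cauchy–Binet this
makes an injective tuple the same as a decreasing tuple together with a permutation. -/
theorem strictAnti_eq_of_comp_perm {d : ℕ} {ι : Type*} [LinearOrder ι] {f g : Fin d → ι}
    (hf : StrictAnti f) (hg : StrictAnti g) {σ τ : Equiv.Perm (Fin d)} (h : f ∘ σ = g ∘ τ) :
    f = g ∧ σ = τ := by
  have hr : Set.range f = Set.range g := by
    rw [← σ.surjective.range_comp f, h, τ.surjective.range_comp]
  have hfg : f = g := by
    have h2 := (StrictMono.range_inj (γ := ιᵒᵈ) hf.dual_right hg.dual_right).1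
      (by rw [Set.range_comp, Set.range_comp, hr])
    exact funext fun i => OrderDual.toDual.injective (congrFun h2 i)
  subst hfg
  exact ⟨rfl, Equiv.ext fun i => hf.injective (congrFun h i)⟩

/-- The Cauchy–Binet formula, as a sum over strictly decreasing tuples. -/
theorem det_sum_mul {d : ℕ} {ι : Type*} [LinearOrder ι] (s : Finset ι) (A : Fin d → ι → K)
    (B : ι → Fin d → K) :
    Matrix.det (Matrix.of fun i j => ∑ k ∈ s, A i k * B k j) =
      ∑ g ∈ (Fintype.piFinset fun _ : Fin d => s) with StrictAnti g,
        Matrix.det (Matrix.of fun i j => A i (g j)) *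
          Matrix.det (Matrix.of fun i j => B (g i) j) := by
  classical
  -- Multilinearity of the determinant in the rows.
  have h1 : Matrix.det (Matrix.of fun i j => ∑ k ∈ s, A i k * B k j) =
      ∑ f ∈ Fintype.piFinset fun _ : Fin d => s,
        (∏ i, A i (f i)) * Matrix.det (Matrix.of fun i j => B (f i) j) := by
    have e : (Matrix.of fun i j => ∑ k ∈ s, A i k * B k j) =
        fun i => ∑ k ∈ s, A i k • B k := by
      ext i j
      simp [Finset.sum_apply]
    rw [e]
    have := (Matrix.detRowAlternating (R := K) (n := Fin d)).toMultilinearMap.map_sum_finset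
      (fun i k => A i k • B k) (fun _ => s)
    refine this.trans (Finset.sum_congr rfl fun f _ => ?_)
    exact (Matrix.detRowAlternating (R := K) (n := Fin d)).toMultilinearMap.map_smul_univ
      (fun i => A i (f i)) (fun i => B (f i))
  rw [h1]
  -- A tuple with a repetition gives a matrix with two equal rows.
  have h2 : ∑ f ∈ Fintype.piFinset fun _ : Fin d => s,
        (∏ i, A i (f i)) * Matrix.det (Matrix.of fun i j => B (f i) j) =
      ∑ f ∈ (Fintype.piFinset fun _ : Fin d => s) with Function.Injective f,
        (∏ i, A i (f i)) * Matrix.det (Matrix.of fun i j => B (f i) j) := by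
    symm
    apply Finset.sum_filter_of_ne
    intro f _ hne i j hij
    by_contra hij'
    refine hne ?_
    rw [Matrix.det_zero_of_row_eq hij' (by ext k; simp [hij]), mul_zero]
  -- The tuples with the same sorted form `g` differ by a permutation; the signs from permuting the
  -- rows of `B` assemble the determinant of `A`.
  have h3 : ∀ g : Fin d → ι, Matrix.det (Matrix.of fun i j => A i (g j)) *
          Matrix.det (Matrix.of fun i j => B (g i) j) = ∑ σ : Equiv.Perm (Fin d),
        (∏ i, A i ((g ∘ σ) i)) * Matrix.det (Matrix.of fun i j => B ((g ∘ σ) i) j) := by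
    intro g
    rw [← Matrix.det_transpose, Matrix.det_apply', Finset.sum_mul]
    refine Finset.sum_congr rfl fun σ _ => ?_
    have : (Matrix.of fun i j => B ((g ∘ σ) i) j) =
        (Matrix.of fun i j => B (g i) j).submatrix σ id := rfl
    rw [this, Matrix.det_permute]
    simp only [Matrix.transpose_apply, Matrix.of_apply, Function.comp_apply]
    ring
  rw [h2, Finset.sum_congr rfl fun g _ => h3 g, ← Finset.sum_product']
  symm
  refine Finset.sum_bij (fun p _ => p.1 ∘ p.2) ?_ ?_ ?_ ?_
  · rintro ⟨g, σ⟩ h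
    simp only [Finset.mem_product, Finset.mem_filter, Fintype.mem_piFinset] at h ⊢
    exact ⟨fun i => h.1.1 _, h.1.2.injective.comp σ.injective⟩
  · rintro ⟨g, σ⟩ h ⟨g', σ'⟩ h' heq
    simp only [Finset.mem_product, Finset.mem_filter] at h h'
    obtain ⟨rfl, rfl⟩ := strictAnti_eq_of_comp_perm h.1.2 h'.1.2 heq
    rfl
  · intro f hf
    simp only [Finset.mem_filter, Fintype.mem_piFinset] at hf
    obtain ⟨σ, hσ⟩ := exists_perm_strictAnti hf.2
    refine ⟨(f ∘ σ, σ⁻¹), ?_, ?_⟩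
    · simp only [Finset.mem_product, Finset.mem_filter, Fintype.mem_piFinset, Finset.mem_univ,
        and_true]
      exact ⟨fun i => hf.1 _, hσ⟩
    · ext i
      simp
  · rintro ⟨g, σ⟩ _
    rfl

/-- The sign of the permutation that sorts the injective tuple `J` into decreasing order. -/
def tupleSign {d : ℕ} (J : Fin d → ℤ) : K :=
  ∏ p, ∏ q ∈ Ioi p, if J p < J q then -1 else 1

/-- A decreasing `J` turns the inversions of `σ` into the ascents of `J ∘ σ`. Signs can thus be read
off the unsorted values, without knowing the permutation. -/
theorem sign_eq_tupleSign {d : ℕ} {J : Fin d → ℤ} (hJ : StrictAnti J) (σ : Equiv.Perm (Fin d)) :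
    ((Equiv.Perm.sign σ : ℤ) : K) = tupleSign (J ∘ σ) := by
  rw [Equiv.Perm.sign_eq_prod_prod_Ioi, tupleSign]
  push_cast
  refine Finset.prod_congr rfl fun p _ => Finset.prod_congr rfl fun q hq => ?_
  have hne : σ p ≠ σ q := fun h => (Finset.mem_Ioi.1 hq).ne (σ.injective h)
  rcases lt_or_gt_of_ne hne with h | h
  · have := hJ h
    simp [h, not_lt.2 this.le]
  · have := hJ h
    simp [this, not_lt.2 h.le]

theorem tupleSign_mul_self {d : ℕ} (J : Fin d → ℤ) :
    (tupleSign J : K) * tupleSign J = 1 := by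
  rw [tupleSign, ← Finset.prod_mul_distrib]
  refine Finset.prod_eq_one fun p _ => ?_
  rw [← Finset.prod_mul_distrib]
  refine Finset.prod_eq_one fun q _ => ?_
  split_ifs <;> simp

/-- Replacing several columns at once, in terms of the replacements of one column. -/
theorem det_mul_pow_of_columns {d r : ℕ} {A B : Matrix (Fin d) (Fin d) K} (hA : A.det ≠ 0)
    {slot : Fin r → Fin d} (hslot : Function.Injective slot)
    (hB : ∀ q, q ∉ Set.range slot → ∀ i, B i q = A i q) :
    B.det * A.det ^ r = A.det * Matrix.det (Matrix.of fun i j =>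
      (A.updateCol (slot j) fun p => B p (slot i)).det) := by
  classical
  have hunit : IsUnit A.det := hA.isUnit
  -- `C` agrees with the identity matrix outside the columns in the slots, so its determinant
  -- reduces to the block of the slots.
  set C := A⁻¹ * B with hC
  have hAC : A * C = B := by rw [hC, ← mul_assoc, Matrix.mul_nonsing_inv _ hunit, one_mul]
  have hcol : ∀ q, q ∉ Set.range slot → ∀ i, C i q = (1 : Matrix (Fin d) (Fin d) K) i q := by
    intro q hq i
    rw [← Matrix.nonsing_inv_mul A hunit, hC, Matrix.mul_apply, Matrix.mul_apply]
    exact Finset.sum_congr rfl fun k _ => by rw [hB q hq]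
  -- Cramer's rule.
  have hentry : ∀ i j, (A.updateCol (slot j) fun p => B p (slot i)).det =
      A.det * C (slot j) (slot i) := by
    intro i j
    rw [← Matrix.cramer_apply, Matrix.cramer_eq_adjugate_mulVec, hC, Matrix.mul_apply,
      Matrix.mulVec, dotProduct, Finset.mul_sum]
    refine Finset.sum_congr rfl fun k _ => ?_
    rw [Matrix.inv_def, Ring.inverse_eq_inv', Matrix.smul_apply, smul_eq_mul]
    field_simp
  have hdetC : C.det = Matrix.det (Matrix.of fun i j => C (slot i) (slot j)) := by
    rw [Matrix.twoBlockTriangular_det C (fun q => q ∉ Set.range slot)]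
    · have e1 : Matrix.toSquareBlockProp C (fun q => q ∉ Set.range slot) = 1 := by
        ext i j
        rw [Matrix.toSquareBlockProp_def, Matrix.of_apply, hcol _ j.2, Matrix.one_apply,
          Matrix.one_apply]
        simp [Subtype.ext_iff]
      rw [e1, Matrix.det_one, one_mul]
      let e : Fin r ≃ {q // ¬ (q ∉ Set.range slot)} :=
        (Equiv.ofInjective slot hslot).trans (Equiv.subtypeEquivRight fun q => not_not.symm)
      rw [← Matrix.det_submatrix_equiv_self e]
      rfl
    · rintro i hi j hj
      rw [hcol j hj, Matrix.one_apply_ne]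
      rintro rfl
      exact hi hj
  have : (Matrix.of fun i j => (A.updateCol (slot j) fun p => B p (slot i)).det) =
      A.det • (Matrix.of fun i j => C (slot i) (slot j)).transpose := by
    ext i j
    simp [hentry]
  rw [this, Matrix.det_smul, Matrix.det_transpose, ← hdetC, ← hAC, Matrix.det_mul,
    Fintype.card_fin]
  ring

end LinearAlgebra

/-! ### Free fermionic rows -/

/-- The vertex weights of one row of a six vertex model, as functions of the column. -/
structure RowWeights (K : Type*) where
  a1 : ℤ → K
  a2 : ℤ → K
  b1 : ℤ → K
  b2 : ℤ → K
  c1 : ℤ → K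
  c2 : ℤ → K

namespace RowWeights

/-- Weight of a vertex in column `k` with given left, top, bottom and right edges. -/
def vertex (W : RowWeights K) (k : ℤ) : Bool → Bool → Bool → Bool → K
  | false, false, false, false => W.a1 k
  | true, true, true, true => W.a2 k
  | false, true, true, false => W.b1 k
  | true, false, false, true => W.b2 k
  | false, true, false, true => W.c1 k
  | true, false, true, false => W.c2 k
  | _, _, _, _ => 0

/-- One column as a matrix indexed by its left and right edges. -/
def column (W : RowWeights K) (k : ℤ) (t s : Bool) : Matrix Bool Bool K :=
  Matrix.of fun l r => W.vertex k l t s r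

/-- The monodromy matrix of the columns `s + 1, …, s + m`. -/
def monodromy (W : RowWeights K) (v w : ℤ → Bool) (s : ℤ) : ℕ → Matrix Bool Bool K
  | 0 => 1
  | m + 1 => monodromy W v w s m * W.column (s + m + 1) (v (s + m + 1)) (w (s + m + 1))

theorem monodromy_succ_left (W : RowWeights K) (v w : ℤ → Bool) (s : ℤ) (m : ℕ) :
    W.monodromy v w s (m + 1) =
      W.column (s + 1) (v (s + 1)) (w (s + 1)) * W.monodromy v w (s + 1) m := by
  induction m with
  | zero => simp [monodromy]
  | succ m ih =>
    rw [monodromy, ih, mul_assoc, monodromy]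
    have e : s + ((m + 1 : ℕ) : ℤ) + 1 = s + 1 + m + 1 := by push_cast; ring
    rw [e]

/-- The weights seen by the holes when the row is read from right to left. -/
def reflect (W : RowWeights K) : RowWeights K where
  a1 k := W.b1 (1 - k)
  a2 k := W.b2 (1 - k)
  b1 k := W.a1 (1 - k)
  b2 k := W.a2 (1 - k)
  c1 k := W.c2 (1 - k)
  c2 k := W.c1 (1 - k)

/-- Only the vertical edges are complemented; the horizontal edges keep their occupation and
exchange sides. This swaps `a1` with `b1`, `a2` with `b2` and `c1` with `c2`. -/
theorem column_reflect (W : RowWeights K) (k : ℤ) (t s : Bool) :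
    W.reflect.column k (!t) (!s) = (W.column (1 - k) t s).transpose := by
  ext l r
  cases l <;> cases r <;> cases t <;> cases s <;> rfl

/-- Reversal turns the product of the columns into the product of transposes in the opposite order.
The map `k ↦ 1 - k` sends the columns `s + 1, …, s + m` to those that start right after `-(s + m)`.
-/
theorem monodromy_reflect (W : RowWeights K) (v w : ℤ → Bool) (s : ℤ) (m : ℕ) :
    W.reflect.monodromy (fun k => !v (1 - k)) (fun k => !w (1 - k)) (-(s + m)) m =
      (W.monodromy v w s m).transpose := by
  induction m with
  | zero => simp [monodromy]
  | succ m ih =>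
    have e1 : -(s + ((m + 1 : ℕ) : ℤ)) + 1 = -(s + m) := by push_cast; ring
    have e2 : 1 - -(s + (m : ℤ)) = s + m + 1 := by ring
    rw [monodromy_succ_left, e1, ih, column_reflect, e2, monodromy, Matrix.transpose_mul]

/-- The amplitude of a path that enters from the top of column `i` and leaves through the left edge
of column `j`, relative to the empty row. -/
def edge (W : RowWeights K) (i j : ℤ) : K :=
  W.c1 i / W.a1 i * ∏ k ∈ Ioo i j, W.b2 k / W.a1 k

/-- The amplitude of a path from the top of column `i` to the bottom of column `j`, relative to the
empty row. -/
def kernel (W : RowWeights K) : IncidenceAlgebra K ℤ where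
  toFun i j := if i = j then W.b1 i / W.a1 i else
    if i < j then W.edge i j * (W.c2 j / W.a1 j) else 0
  eq_zero_of_not_le' i j h := by
    rw [if_neg (fun h' => h h'.le), if_neg (fun h' => h h'.le)]

theorem kernel_apply (W : RowWeights K) (i j : ℤ) :
    W.kernel i j = if i = j then W.b1 i / W.a1 i else
      if i < j then W.edge i j * (W.c2 j / W.a1 j) else 0 := rfl

theorem kernel_self (W : RowWeights K) (i : ℤ) : W.kernel i i = W.b1 i / W.a1 i := by
  simp [kernel_apply]

theorem kernel_of_lt (W : RowWeights K) {i j : ℤ} (h : i < j) :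
    W.kernel i j = W.c2 j / W.a1 j * W.edge i j := by
  rw [kernel_apply, if_neg h.ne, if_pos h, mul_comm]

theorem edge_succ (W : RowWeights K) {i j : ℤ} (h : i < j) :
    W.edge i (j + 1) = W.b2 j / W.a1 j * W.edge i j := by
  have : Ioo i (j + 1) = insert j (Ioo i j) := by
    ext k
    simp only [Finset.mem_Ioo, Finset.mem_insert]
    omega
  rw [edge, edge, this, Finset.prod_insert (by simp)]
  ring

theorem edge_self (W : RowWeights K) (i : ℤ) : W.edge i (i + 1) = W.c1 i / W.a1 i := by
  have : Ioo i (i + 1) = ∅ := by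
    ext k
    simp only [Finset.mem_Ioo, Finset.notMem_empty, iff_false]
    omega
  rw [edge, this, Finset.prod_empty, mul_one]

end RowWeights

/-- `I` lists the occupied positions of `v` among `s + 1, …, s + m` in decreasing order. -/
structure Enumerates (v : ℤ → Bool) (s : ℤ) (m : ℕ) {p : ℕ} (I : Fin p → ℤ) : Prop where
  strictAnti : StrictAnti I
  mem_iff : ∀ k, (∃ q, I q = k) ↔ s < k ∧ k ≤ s + m ∧ v k = true

namespace Enumerates

variable {v : ℤ → Bool} {s : ℤ} {m p : ℕ}

theorem lt {I : Fin p → ℤ} (h : Enumerates v s m I) (q : Fin p) : I q < s + m + 1 := by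
  have := (h.mem_iff (I q)).1 ⟨q, rfl⟩
  omega

theorem of_false {I : Fin p → ℤ} (h : Enumerates v s (m + 1) I) (hv : v (s + m + 1) = false) :
    Enumerates v s m I := by
  refine ⟨h.strictAnti, fun k => (h.mem_iff k).trans ?_⟩
  push_cast
  constructor
  · rintro ⟨h1, h2, h3⟩
    refine ⟨h1, ?_, h3⟩
    have : k ≠ s + m + 1 := by
      rintro rfl
      simp [hv] at h3
    omega
  · rintro ⟨h1, h2, h3⟩
    exact ⟨h1, by omega, h3⟩

theorem not_zero {I : Fin 0 → ℤ} (h : Enumerates v s (m + 1) I) (hv : v (s + m + 1) = true) :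
    False := by
  obtain ⟨q, -⟩ := (h.mem_iff (s + m + 1)).2 ⟨by omega, by push_cast; omega, hv⟩
  exact q.elim0

theorem zero_eq {I : Fin (p + 1) → ℤ} (h : Enumerates v s (m + 1) I)
    (hv : v (s + m + 1) = true) : I 0 = s + m + 1 := by
  obtain ⟨q, hq⟩ := (h.mem_iff (s + m + 1)).2 ⟨by omega, by push_cast; omega, hv⟩
  have h1 := h.lt 0
  have h2 := h.strictAnti.antitone (Fin.zero_le q)
  push_cast at h1
  omega

theorem tail {I : Fin (p + 1) → ℤ} (h : Enumerates v s (m + 1) I)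
    (hv : v (s + m + 1) = true) : Enumerates v s m fun q => I (Fin.succ q) := by
  have h0 := h.zero_eq hv
  refine ⟨fun q q' hqq => h.strictAnti (Fin.succ_lt_succ_iff.2 hqq), fun k => ?_⟩
  constructor
  · rintro ⟨q, rfl⟩
    have h1 := (h.mem_iff (I q.succ)).1 ⟨_, rfl⟩
    have h2 := h.strictAnti (Fin.succ_pos q)
    exact ⟨h1.1, by omega, h1.2.2⟩
  · rintro ⟨h1, h2, h3⟩
    obtain ⟨q, hq⟩ := (h.mem_iff k).2 ⟨h1, by push_cast; omega, h3⟩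
    have : q ≠ 0 := by
      rintro rfl
      omega
    exact ⟨q.pred this, by rw [Fin.succ_pred, hq]⟩

end Enumerates

/-! ### Determinant expansions for adding a last column -/

theorem det_of_row_zero {p : ℕ} (A : Matrix (Fin (p + 1)) (Fin (p + 1)) K)
    (h : ∀ j : Fin p, A 0 j.succ = 0) :
    A.det = A 0 0 * (A.submatrix Fin.succ Fin.succ).det := by
  rw [Matrix.det_succ_row_zero, Fin.sum_univ_succ]
  simp [h]

theorem det_cons_mul {p : ℕ} (c : K) (f : Fin (p + 1) → K) (g : Fin (p + 1) → Fin p → K) :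
    Matrix.det (Matrix.of fun i => (Fin.cons (c * f i) (g i) : Fin (p + 1) → K)) =
      c * Matrix.det (Matrix.of fun i => (Fin.cons (f i) (g i) : Fin (p + 1) → K)) := by
  rw [Matrix.det_succ_column_zero, Matrix.det_succ_column_zero, Finset.mul_sum]
  refine Finset.sum_congr rfl fun i _ => ?_
  have : ∀ f' : Fin (p + 1) → K,
      (Matrix.of fun i => (Fin.cons (f' i) (g i) : Fin (p + 1) → K)).submatrix i.succAbove
        Fin.succ = Matrix.of fun q => g (i.succAbove q) := by
    intro f'
    ext q j
    simp
  rw [this, this]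
  simp only [Matrix.of_apply, Fin.cons_zero]
  ring

/-- The determinant for the two paths through the last column, expanded along its row. -/
theorem det_two_columns {p : ℕ} (u u' c c' : K) (f : Fin (p + 1) → K)
    (g : Fin (p + 1) → Fin p → K) (A : Matrix (Fin (p + 2)) (Fin (p + 2)) K)
    (h00 : A 0 0 = u) (h01 : A 0 1 = u') (h0 : ∀ j : Fin p, A 0 j.succ.succ = 0)
    (hc : ∀ i : Fin (p + 1), A i.succ 0 = c * f i) (hc' : ∀ i : Fin (p + 1), A i.succ 1 = c' * f i)
    (hg : ∀ (i : Fin (p + 1)) (j : Fin p), A i.succ j.succ.succ = g i j) :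
    A.det = (u * c' - u' * c) *
      Matrix.det (Matrix.of fun i => (Fin.cons (f i) (g i) : Fin (p + 1) → K)) := by
  have e0 : A.submatrix Fin.succ (Fin.succAbove 0) =
      Matrix.of fun i => (Fin.cons (c' * f i) (g i) : Fin (p + 1) → K) := by
    ext i j
    refine Fin.cases ?_ (fun j => ?_) j
    · simp [← hc']
    · simp [← hg]
  have e1 : A.submatrix Fin.succ (Fin.succAbove (Fin.succ 0)) =
      Matrix.of fun i => (Fin.cons (c * f i) (g i) : Fin (p + 1) → K) := by
    ext i j
    refine Fin.cases ?_ (fun j => ?_) j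
    · simp [← hc]
    · simp [← hg]
  rw [Matrix.det_succ_row_zero, Fin.sum_univ_succ, Fin.sum_univ_succ, e0, e1, det_cons_mul,
    det_cons_mul, Finset.sum_eq_zero fun j _ => by rw [h0]; ring]
  rw [h00, Fin.succ_zero_eq_one, h01]
  simp only [Fin.val_zero, Fin.val_one, pow_zero, pow_one]
  ring

theorem det_of_eq_cons {p : ℕ} (G : Fin (p + 1) → Fin (p + 1) → K) :
    Matrix.det (Matrix.of fun i j => G i j) =
      Matrix.det (Matrix.of fun i =>
        (Fin.cons (G i 0) (fun q => G i (Fin.succ q)) : Fin (p + 1) → K)) := by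
  congr 1
  ext i j
  refine Fin.cases ?_ (fun j => ?_) j <;> simp

namespace RowWeights

theorem monodromy_succ_apply (W : RowWeights K) (v w : ℤ → Bool) (s : ℤ) (m : ℕ) (l r : Bool) :
    W.monodromy v w s (m + 1) l r =
      W.monodromy v w s m l true *
          W.vertex (s + m + 1) true (v (s + m + 1)) (w (s + m + 1)) r +
        W.monodromy v w s m l false *
          W.vertex (s + m + 1) false (v (s + m + 1)) (w (s + m + 1)) r := by
  rw [monodromy, Matrix.mul_apply, Fintype.sum_bool]
  rfl

/-- Free fermionic rows are given by determinants of one path amplitudes: the case of an empty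
right edge, and the case of an occupied right edge. -/
theorem monodromy_eq_det_aux (W : RowWeights K) (ha : ∀ k, W.a1 k ≠ 0)
    (hW : ∀ k, W.a1 k * W.a2 k + W.b1 k * W.b2 k = W.c1 k * W.c2 k) (v w : ℤ → Bool) (s : ℤ)
    (m : ℕ) :
    (∀ (p : ℕ) (I J : Fin p → ℤ), Enumerates v s m I → Enumerates w s m J →
      W.monodromy v w s m false false = (∏ k ∈ range m, W.a1 (s + k + 1)) *
        Matrix.det (Matrix.of fun i j => W.kernel (I i) (J j))) ∧
    (∀ (p : ℕ) (I : Fin (p + 1) → ℤ) (J : Fin p → ℤ), Enumerates v s m I → Enumerates w s m J →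
      W.monodromy v w s m false true = (∏ k ∈ range m, W.a1 (s + k + 1)) *
        Matrix.det (Matrix.of fun i => (Fin.cons (W.edge (I i) (s + m + 1))
          (fun q => W.kernel (I i) (J q)) : Fin (p + 1) → K))) := by
  induction m with
  | zero =>
    constructor
    · intro p I J hI hJ
      cases p with
      | zero => simp [monodromy]
      | succ p =>
        have := (hI.mem_iff (I 0)).1 ⟨0, rfl⟩
        simp only [Nat.cast_zero] at this
        omega
    · intro p I J hI hJ
      have := (hI.mem_iff (I 0)).1 ⟨0, rfl⟩
      simp only [Nat.cast_zero] at this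
      omega
  | succ m ih =>
    obtain ⟨ih1, ih2⟩ := ih
    have hk := ha (s + m + 1)
    constructor
    · intro p I J hI hJ
      rw [monodromy_succ_apply, Finset.prod_range_succ]
      rcases hv : v (s + m + 1) <;> rcases hw : w (s + m + 1)
      · rw [ih1 p I J (hI.of_false hv) (hJ.of_false hw)]
        simp only [vertex]
        ring
      -- A path coming from the left turns down: its amplitude `kernel` is the `edge` amplitude
      -- times `c2 / a1`.
      · cases p with
        | zero => exact (hJ.not_zero hw).elim
        | succ p =>
          rw [ih2 p I _ (hI.of_false hv) (hJ.tail hw),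
            det_of_eq_cons fun i j => W.kernel (I i) (J j)]
          have e : ∀ i, W.kernel (I i) (J 0) =
              W.c2 (s + m + 1) / W.a1 (s + m + 1) * W.edge (I i) (s + m + 1) := by
            intro i
            rw [hJ.zero_eq hw, W.kernel_of_lt ((hI.of_false hv).lt i)]
          simp only [e, det_cons_mul, vertex]
          field_simp
          ring
      -- No vertex has only its top edge and possibly its left edge occupied while both outgoing
      -- edges are empty. In the determinant, the path from the last column has no target to its
      -- right.
      · cases p with
        | zero => exact (hI.not_zero hv).elim
        | succ p =>
          rw [Matrix.det_eq_zero_of_row_eq_zero 0]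
          · simp [vertex]
          · intro j
            rw [Matrix.of_apply, hI.zero_eq hv]
            exact IncidenceAlgebra.apply_eq_zero_of_not_le
              (not_le.2 ((hJ.of_false hw).lt j)) _
      -- The path from the top of the last column can only go straight down.
      · cases p with
        | zero => exact (hJ.not_zero hw).elim
        | succ p =>
          rw [ih1 p _ _ (hI.tail hv) (hJ.tail hw), det_of_row_zero]
          · rw [Matrix.of_apply, hI.zero_eq hv, hJ.zero_eq hw, W.kernel_self]
            simp only [vertex, Matrix.submatrix, Matrix.of_apply]
            field_simp
            ring
          · intro j
            rw [Matrix.of_apply, hI.zero_eq hv]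
            exact IncidenceAlgebra.apply_eq_zero_of_not_le
              (not_le.2 ((hJ.tail hw).lt j)) _
    · intro p I J hI hJ
      rw [monodromy_succ_apply, Finset.prod_range_succ]
      have e1 : s + ((m + 1 : ℕ) : ℤ) + 1 = s + m + 1 + 1 := by push_cast; ring
      rw [e1]
      rcases hv : v (s + m + 1) <;> rcases hw : w (s + m + 1)
      · rw [ih2 p I J (hI.of_false hv) (hJ.of_false hw)]
        simp only [fun i => W.edge_succ ((hI.of_false hv).lt i), det_cons_mul, vertex]
        field_simp
        ring
      · cases p with
        | zero => exact (hJ.not_zero hw).elim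
        | succ p =>
          have e : Matrix.det (Matrix.of fun i => (Fin.cons (W.edge (I i) (s + m + 1 + 1))
              (fun q => W.kernel (I i) (J q)) : Fin (p + 2) → K)) = 0 := by
            simp only [fun i => W.edge_succ ((hI.of_false hv).lt i), det_cons_mul]
            rw [← mul_zero (W.b2 (s + m + 1) / W.a1 (s + m + 1))]
            congr 1
            -- The `edge` column and the column of the last particle are both multiples of the
            -- amplitudes `edge (I i) (s + m + 1)`, so the determinant vanishes. Making the columns
            -- equal requires `c2 ≠ 0`; otherwise the second of them is zero.
            by_cases hc : W.c2 (s + m + 1) = 0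
            · refine Matrix.det_eq_zero_of_column_eq_zero 1 fun i => ?_
              have : (1 : Fin (p + 2)) = Fin.succ 0 := rfl
              rw [Matrix.of_apply, this, Fin.cons_succ, hJ.zero_eq hw,
                W.kernel_of_lt ((hI.of_false hv).lt i), hc]
              simp
            · have hc' : W.c2 (s + m + 1) / W.a1 (s + m + 1) ≠ 0 := div_ne_zero hc hk
              refine (mul_eq_zero.1 ?_).resolve_left hc'
              rw [← det_cons_mul]
              refine Matrix.det_zero_of_column_eq (i := 0) (j := 1) (by simp) fun i => ?_
              have : (1 : Fin (p + 2)) = Fin.succ 0 := rfl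
              rw [Matrix.of_apply, Matrix.of_apply, this, Fin.cons_succ, Fin.cons_zero,
                hJ.zero_eq hw, W.kernel_of_lt ((hI.of_false hv).lt i)]
          rw [e]
          simp [vertex]
      · rw [ih1 p _ _ (hI.tail hv) (hJ.of_false hw), det_of_row_zero]
        · rw [Matrix.of_apply, hI.zero_eq hv, Fin.cons_zero, W.edge_self]
          simp only [vertex, Matrix.submatrix, Matrix.of_apply, Fin.cons_succ]
          field_simp
          ring
        · intro j
          rw [Matrix.of_apply, hI.zero_eq hv, Fin.cons_succ]
          exact IncidenceAlgebra.apply_eq_zero_of_not_le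
            (not_le.2 ((hJ.of_false hw).lt j)) _
      · cases p with
        | zero => exact (hJ.not_zero hw).elim
        | succ p =>
          rw [ih2 p _ _ (hI.tail hv) (hJ.tail hw)]
          have one_eq : (1 : Fin (p + 2)) = Fin.succ 0 := rfl
          rw [det_two_columns (W.c1 (s + m + 1) / W.a1 (s + m + 1))
            (W.b1 (s + m + 1) / W.a1 (s + m + 1)) (W.b2 (s + m + 1) / W.a1 (s + m + 1))
            (W.c2 (s + m + 1) / W.a1 (s + m + 1))
            (fun i => W.edge (I i.succ) (s + m + 1))
            (fun i j => W.kernel (I i.succ) (J j.succ))]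
          -- The free fermion condition enters here: the two ways to match the last top edge with
          -- the bottom and right edges combine to `c1 * c2 - b1 * b2 = a1 * a2`.
          · have h2 : W.c1 (s + m + 1) / W.a1 (s + m + 1) * (W.c2 (s + m + 1) / W.a1 (s + m + 1)) -
                W.b1 (s + m + 1) / W.a1 (s + m + 1) * (W.b2 (s + m + 1) / W.a1 (s + m + 1)) =
                W.a2 (s + m + 1) / W.a1 (s + m + 1) := by
              field_simp
              linear_combination -hW (s + m + 1)
            rw [h2]
            simp only [vertex]
            field_simp
            ring
          · rw [Matrix.of_apply, hI.zero_eq hv, Fin.cons_zero, W.edge_self]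
          · rw [Matrix.of_apply, hI.zero_eq hv, one_eq, Fin.cons_succ, hJ.zero_eq hw, W.kernel_self]
          · intro j
            rw [Matrix.of_apply, hI.zero_eq hv, Fin.cons_succ]
            exact IncidenceAlgebra.apply_eq_zero_of_not_le
              (not_le.2 ((hJ.tail hw).lt j)) _
          · intro i
            rw [Matrix.of_apply, Fin.cons_zero, W.edge_succ ((hI.tail hv).lt i)]
          · intro i
            rw [Matrix.of_apply, one_eq, Fin.cons_succ, hJ.zero_eq hw,
              W.kernel_of_lt ((hI.tail hv).lt i)]
          · intro i j
            rw [Matrix.of_apply, Fin.cons_succ]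

end RowWeights

/-! ### Young diagrams as decreasing tuples -/

/-- The occupied position `λ_i - i` of the Maya diagram (here `i` starts from `0`). -/
def pos (lam : YoungDiagram) (i : ℕ) : ℤ := (lam.rowLen i : ℤ) - i

theorem pos_strictAnti (lam : YoungDiagram) : StrictAnti (pos lam) := by
  intro i j hij
  have := lam.rowLen_anti i j hij.le
  simp only [pos]
  omega

theorem pos_fin_strictAnti (lam : YoungDiagram) (d : ℕ) :
    StrictAnti fun i : Fin d => pos lam i :=
  fun _ _ hij => pos_strictAnti lam hij

theorem rowLen_le_of_le {mu lam : YoungDiagram} (h : mu ≤ lam) (i : ℕ) :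
    mu.rowLen i ≤ lam.rowLen i := by
  by_contra hlt
  have h1 : (i, lam.rowLen i) ∈ mu := YoungDiagram.mem_iff_lt_rowLen.2 (not_le.1 hlt)
  have h2 : (i, lam.rowLen i) ∈ lam := YoungDiagram.cells_subset_iff.2 h h1
  have := YoungDiagram.mem_iff_lt_rowLen.1 h2
  omega

theorem colLen_le_of_le {mu lam : YoungDiagram} (h : mu ≤ lam) (i : ℕ) :
    mu.colLen i ≤ lam.colLen i := by
  have := rowLen_le_of_le (YoungDiagram.transpose_mono h) i
  simpa using this

theorem eq_of_rowLen_eq {mu lam : YoungDiagram} (h : ∀ i, mu.rowLen i = lam.rowLen i) :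
    mu = lam := by
  apply YoungDiagram.ext
  ext ⟨i, j⟩
  rw [YoungDiagram.mem_cells, YoungDiagram.mem_cells, YoungDiagram.mem_iff_lt_rowLen,
    YoungDiagram.mem_iff_lt_rowLen, h]

theorem eq_of_pos_eq {mu lam : YoungDiagram} {d : ℕ} (hmu : mu.colLen 0 ≤ d)
    (hlam : lam.colLen 0 ≤ d) (h : ∀ i : Fin d, pos mu i = pos lam i) : mu = lam := by
  refine eq_of_rowLen_eq fun i => ?_
  by_cases hi : i < d
  · have := h ⟨i, hi⟩
    simp only [pos] at this
    omega
  · rw [rowLen_eq_zero_of_le (by omega), rowLen_eq_zero_of_le (by omega)]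

/-- The numbers `g i + i` are the row lengths of the diagram to be built from `g`, so they have to
be weakly decreasing. -/
theorem add_le_add_of_strictAnti {d : ℕ} {g : Fin d → ℤ} (hg : StrictAnti g) {i j : Fin d}
    (hij : i ≤ j) : g j + (j : ℕ) ≤ g i + (i : ℕ) := by
  obtain ⟨i, hi⟩ := i
  obtain ⟨j, hj⟩ := j
  replace hij : i ≤ j := hij
  induction j, hij using Nat.le_induction with
  | base => exact le_rfl
  | succ j hij ih =>
    have h1 := ih (by omega)
    have h2 : g ⟨j + 1, hj⟩ < g ⟨j, by omega⟩ := hg (by simp)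
    push_cast at h1 ⊢
    omega

/-- The lower bound `1 - d` makes the last row length `g (d - 1) + (d - 1)` nonnegative, and hence
all of them. -/
theorem exists_diagram {d : ℕ} (g : Fin d → ℤ) (hg : StrictAnti g)
    (hd : ∀ i, 1 - (d : ℤ) ≤ g i) :
    ∃ nu : YoungDiagram, nu.colLen 0 ≤ d ∧ ∀ i : Fin d, pos nu i = g i := by
  have h0 : ∀ i : Fin d, 0 ≤ g i + (i : ℕ) := by
    intro i
    have hi := i.2
    have h1 := add_le_add_of_strictAnti hg (i := i) (j := ⟨d - 1, by omega⟩)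
      (Fin.le_def.2 (by simp only; omega))
    have h2 := hd ⟨d - 1, by omega⟩
    have h3 : ((d - 1 : ℕ) : ℤ) = d - 1 := by omega
    simp only [h3] at h1
    omega
  let nu : YoungDiagram :=
    { cells := Finset.univ.biUnion fun i : Fin d => {(i : ℕ)} ×ˢ range (g i + (i : ℕ)).toNat
      isLowerSet := by
        rintro ⟨r, c⟩ ⟨r', c'⟩ ⟨h1, h2⟩ h
        simp only [Finset.mem_coe, Finset.mem_biUnion, Finset.mem_univ, true_and,
          Finset.mem_product, Finset.mem_singleton, Finset.mem_range] at h h1 h2 ⊢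
        obtain ⟨i, rfl, hc⟩ := h
        have hi := i.2
        have h3 := add_le_add_of_strictAnti hg (i := ⟨r', by omega⟩) (j := i) (Fin.le_def.2 h1)
        refine ⟨⟨r', by omega⟩, rfl, ?_⟩
        simp only at h3 ⊢
        omega }
  have hmem : ∀ r c, (r, c) ∈ nu ↔ ∃ i : Fin d, (i : ℕ) = r ∧ c < (g i + (i : ℕ)).toNat := by
    intro r c
    rw [← YoungDiagram.mem_cells]
    simp only [nu, Finset.mem_biUnion, Finset.mem_univ, true_and,
      Finset.mem_product, Finset.mem_singleton, Finset.mem_range]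
    constructor
    · rintro ⟨i, rfl, h⟩
      exact ⟨i, rfl, h⟩
    · rintro ⟨i, rfl, h⟩
      exact ⟨i, rfl, h⟩
  refine ⟨nu, ?_, fun i => ?_⟩
  · by_contra hlt
    obtain ⟨i, hi, -⟩ := (hmem _ _).1 (YoungDiagram.mem_iff_lt_colLen.2 (not_le.1 hlt))
    have := i.2
    omega
  · have hrow : nu.rowLen i = (g i + (i : ℕ)).toNat := by
      apply le_antisymm
      · by_contra hlt
        obtain ⟨i', hi', h⟩ := (hmem _ _).1 (YoungDiagram.mem_iff_lt_rowLen.2 (not_le.1 hlt))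
        obtain rfl : i' = i := Fin.ext hi'
        omega
      · by_contra hlt
        have h1 := YoungDiagram.mem_iff_lt_rowLen.1 ((hmem i (nu.rowLen i)).2 ⟨i, rfl, not_le.1 hlt⟩)
        omega
    have := h0 i
    rw [pos, hrow]
    omega

/-- Along the boundary of the diagram, particles are the vertical steps and holes the horizontal
ones; transposition exchanges the two and reverses the direction. -/
theorem maya_transpose (lam : YoungDiagram) (k : ℤ) :
    maya lam.transpose k = !maya lam (1 - k) := by
  have key : maya lam.transpose k = true ↔ ¬ maya lam (1 - k) = true := by
    rw [maya_eq_true_iff, maya_eq_true_iff]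
    simp only [YoungDiagram.rowLen_transpose]
    constructor
    · rintro ⟨i, hi⟩ ⟨j, hj⟩
      -- A coincidence would mean `rowLen j + colLen i = i + j + 1`, but the sum is at least `i + j
      -- + 2` if the box lies in `lam` and at most `i + j` if not.
      by_cases h : (j, i) ∈ lam
      · have h1 := YoungDiagram.mem_iff_lt_rowLen.1 h
        have h2 := YoungDiagram.mem_iff_lt_colLen.1 h
        omega
      · have h1 := mt YoungDiagram.mem_iff_lt_rowLen.2 h
        have h2 := mt YoungDiagram.mem_iff_lt_colLen.2 h
        omega
    · intro hno
      -- The column belonging to the hole `1 - k` ends above the first row `j` whose position is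
      -- below the hole; this forces its length to be `j` and its index to be `j - k`.
      have hex : ∃ j : ℕ, (lam.rowLen j : ℤ) - j < 1 - k := by
        refine ⟨lam.rowLen 0 + k.natAbs, ?_⟩
        have := lam.rowLen_anti 0 (lam.rowLen 0 + k.natAbs) (Nat.zero_le _)
        omega
      classical
      have hj := Nat.find_spec hex
      have hmin := fun i => Nat.find_min (H := hex) (m := i)
      set j := Nat.find hex
      obtain ⟨i, hi⟩ : ∃ i : ℕ, (i : ℤ) = j - k := ⟨(j - k : ℤ).toNat, by omega⟩
      refine ⟨i, ?_⟩
      have h1 : lam.colLen i ≤ j := by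
        by_contra hlt
        have := YoungDiagram.mem_iff_lt_rowLen.1 (YoungDiagram.mem_iff_lt_colLen.2 (not_le.1 hlt))
        omega
      have h2 : j ≤ lam.colLen i := by
        rcases Nat.eq_zero_or_pos j with h | h
        · omega
        · have h3 := hmin (j - 1) (by omega)
          have h4 : (lam.rowLen (j - 1) : ℤ) - (j - 1 : ℕ) ≠ 1 - k := fun h => hno ⟨j - 1, h.symm⟩
          have : (j - 1, i) ∈ lam := YoungDiagram.mem_iff_lt_rowLen.2 (by omega)
          have := YoungDiagram.mem_iff_lt_colLen.1 this
          omega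
      omega
  cases h : maya lam (1 - k) <;> simp_all

theorem enumerates_maya {lam : YoungDiagram} {N M : ℕ} (hN : lam.colLen 0 ≤ N)
    (hM : lam.rowLen 0 ≤ M) :
    Enumerates (maya lam) (-(N : ℤ)) (N + M) fun i : Fin N => pos lam i := by
  refine ⟨pos_fin_strictAnti lam N, fun k => ?_⟩
  rw [maya_eq_true_iff]
  push_cast
  constructor
  · rintro ⟨q, rfl⟩
    have := lam.rowLen_anti 0 q (Nat.zero_le _)
    have := q.2
    simp only [pos]
    exact ⟨by omega, by omega, q, rfl⟩
  · rintro ⟨h1, h2, i, rfl⟩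
    by_cases hi : i < N
    · exact ⟨⟨i, hi⟩, rfl⟩
    · rw [rowLen_eq_zero_of_le (by omega : lam.colLen 0 ≤ i)] at h1
      omega

/-! ### Minors of triangular matrices over ℤ -/

/-- The minor of `G` for the rows `mu` and the columns `lam`, with `d` particles. -/
def minor (G : IncidenceAlgebra K ℤ) (d : ℕ) (mu lam : YoungDiagram) : K :=
  Matrix.det (Matrix.of fun i j : Fin d => G (pos mu i) (pos lam j))

/-- Triangularity confines the intermediate positions to a finite interval, where Cauchy–Binet
applies, and decreasing tuples in it are diagrams with at most `d` rows. The exact set `T` is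
irrelevant; it only has to contain all diagrams below `lam` with at most `d` rows. -/
theorem minor_mul (G G' : IncidenceAlgebra K ℤ) {d : ℕ} {mu lam : YoungDiagram} :
    ∃ T : Finset YoungDiagram, (∀ nu ≤ lam, nu.colLen 0 ≤ d → nu ∈ T) ∧
      (∀ nu ∈ T, nu.colLen 0 ≤ d) ∧
      minor (G * G') d mu lam = ∑ nu ∈ T, minor G d mu nu * minor G' d nu lam := by
  classical
  set s : Finset ℤ := Icc (1 - (d : ℤ)) (lam.rowLen 0) with hs
  have hlow : ∀ (nu : YoungDiagram) (i : Fin d), 1 - (d : ℤ) ≤ pos nu i := by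
    intro nu i
    have := i.2
    simp only [pos]
    omega
  have hhigh : ∀ i : ℕ, pos lam i ≤ lam.rowLen 0 := by
    intro i
    have := lam.rowLen_anti 0 i (Nat.zero_le _)
    simp only [pos]
    omega
  have hentry : ∀ i j : Fin d, (G * G') (pos mu i) (pos lam j) =
      ∑ k ∈ s, G (pos mu i) k * G' k (pos lam j) := by
    intro i j
    rw [IncidenceAlgebra.mul_apply]
    refine Finset.sum_subset (Finset.Icc_subset_Icc (hlow mu i) (hhigh j)) fun k _ hk => ?_
    rw [Finset.mem_Icc, not_and_or] at hk
    rcases hk with hk | hk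
    · rw [IncidenceAlgebra.apply_eq_zero_of_not_le hk, zero_mul]
    · rw [IncidenceAlgebra.apply_eq_zero_of_not_le hk, mul_zero]
  choose! f hf using fun g : Fin d → ℤ => fun h : StrictAnti g ∧ ∀ i, 1 - (d : ℤ) ≤ g i =>
    exists_diagram g h.1 h.2
  set S := (Fintype.piFinset fun _ : Fin d => s).filter StrictAnti with hS
  have hmemS : ∀ g ∈ S, StrictAnti g ∧ ∀ i, 1 - (d : ℤ) ≤ g i := by
    intro g hg
    rw [hS, Finset.mem_filter, Fintype.mem_piFinset] at hg
    exact ⟨hg.2, fun i => (Finset.mem_Icc.1 (hg.1 i)).1⟩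
  refine ⟨S.image f, fun nu hle hnu => ?_, fun nu hnu => ?_, ?_⟩
  · have hS' : (fun i : Fin d => pos nu i) ∈ S := by
      rw [hS, Finset.mem_filter, Fintype.mem_piFinset]
      refine ⟨fun i => Finset.mem_Icc.2 ⟨hlow nu i, ?_⟩, pos_fin_strictAnti nu d⟩
      have h1 := rowLen_le_of_le hle i
      have h2 := hhigh i
      simp only [pos] at h2 ⊢
      omega
    refine Finset.mem_image.2 ⟨_, hS', ?_⟩
    have := hf _ (hmemS _ hS')
    exact eq_of_pos_eq this.1 hnu this.2
  · obtain ⟨g, hg, rfl⟩ := Finset.mem_image.1 hnu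
    exact (hf g (hmemS g hg)).1
  · rw [Finset.sum_image]
    · rw [minor]
      simp only [hentry]
      rw [det_sum_mul]
      refine Finset.sum_congr rfl fun g hg => ?_
      have := (hf g (hmemS g hg)).2
      simp only [minor, this]
    · intro g hg g' hg' h
      funext i
      rw [← (hf g (hmemS g hg)).2 i, ← (hf g' (hmemS g' hg')).2 i, h]

/-- The positions decrease and `G` vanishes on decreasing pairs, so the matrix is triangular. -/
theorem minor_self (G : IncidenceAlgebra K ℤ) (d : ℕ) (mu : YoungDiagram) :
    minor G d mu mu = ∏ i : Fin d, G (pos mu i) (pos mu i) := by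
  rw [minor, Matrix.det_of_isLowerTriangular]
  · rfl
  · intro i j hij
    exact IncidenceAlgebra.apply_eq_zero_of_not_le
      (not_le.2 (pos_fin_strictAnti mu d (OrderDual.toDual_lt_toDual.1 hij))) _

open Classical in
theorem minor_one (d : ℕ) {mu lam : YoungDiagram} (hmu : mu.colLen 0 ≤ d)
    (hlam : lam.colLen 0 ≤ d) :
    minor (1 : IncidenceAlgebra K ℤ) d mu lam = if mu = lam then 1 else 0 := by
  split_ifs with h
  · subst h
    simp [minor_self]
  · by_contra hne
    apply h
    have hrow : ∀ i : Fin d, ∃ j : Fin d, pos mu i = pos lam j := by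
      intro i
      by_contra hno
      push Not at hno
      refine hne (Matrix.det_eq_zero_of_row_eq_zero i fun j => ?_)
      rw [Matrix.of_apply, IncidenceAlgebra.one_apply, if_neg (hno j)]
    obtain ⟨σ, hσ⟩ := exists_perm_comp (pos_fin_strictAnti mu d).injective hrow
    have := (strictAnti_eq_of_comp_perm (pos_fin_strictAnti mu d) (pos_fin_strictAnti lam d)
      (σ := 1) (τ := σ) hσ).1
    exact eq_of_pos_eq hmu hlam fun i => congrFun this i

/-! ### Rows of the free fermionic model -/

/-- The weights of the row with parameters `x, y`. -/
def rowWeights (a b : ℤ → K) (x y : K) : RowWeights K where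
  a1 k := 1 - b k * x
  a2 k := y + a k
  b1 k := 1 + b k * y
  b2 k := x - a k
  c1 k := 1 - a k * b k
  c2 _ := x + y

theorem monodromy_eq (a b : ℤ → K) (x y : K) (v w : ℤ → Bool) (s : ℤ) (m : ℕ) :
    monodromy a b x y v w s m = (rowWeights a b x y).monodromy v w s m := by
  induction m with
  | zero => simp [monodromy, columns, RowWeights.monodromy]
  | succ m ih =>
    rw [monodromy_add, monodromy_one, ih, RowWeights.monodromy]
    congr 1

/-- Cutting the row at `N = d` leaves exactly `d` particles. The determinant formula divides every
column by `1 - b_k x`, while `coeffA` divides the columns `-d + 1, …, 0` by `1 + b_k y`; the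
prefactor is the quotient. -/
theorem coeffA_eq_minor (a b : ℤ → K) (x y : K) (hx : ∀ k, 1 - b k * x ≠ 0)
    (hy : ∀ k, 1 + b k * y ≠ 0) {mu lam : YoungDiagram} {d : ℕ} (hmu : mu.colLen 0 ≤ d)
    (hlam : lam.colLen 0 ≤ d) :
    (∏ j ∈ range d, (1 + b (-(j : ℤ)) * y) / (1 - b (-(j : ℤ)) * x)) *
      coeffA a b x y mu lam = minor (rowWeights a b x y).kernel d mu lam := by
  set M := max (mu.rowLen 0) (lam.rowLen 0) with hM
  rw [← normRowCoeff_eq_coeffA a b x y hx hy mu lam d M (max_le hmu hlam) le_rfl, normRowCoeff,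
    rowCoeff, monodromy_eq,
    ((rowWeights a b x y).monodromy_eq_det_aux hx (fun k => by simp only [rowWeights]; ring)
      (maya mu) (maya lam) (-(d : ℤ)) (d + M)).1 d _ _
      (enumerates_maya hmu (le_max_left _ _)) (enumerates_maya hlam (le_max_right _ _)),
    Finset.prod_range_add, Finset.prod_div_distrib, ← minor]
  have e1 : ∏ k ∈ range d, (rowWeights a b x y).a1 (-(d : ℤ) + k + 1) =
      ∏ j ∈ range d, (1 - b (-(j : ℤ)) * x) := by
    rw [← Finset.prod_range_reflect]
    refine Finset.prod_congr rfl fun j hj => ?_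
    have := Finset.mem_range.1 hj
    have e : -(d : ℤ) + ((d - 1 - j : ℕ) : ℤ) + 1 = -(j : ℤ) := by omega
    rw [e]
    rfl
  have e2 : ∏ k ∈ range M, (rowWeights a b x y).a1 (-(d : ℤ) + ((d + k : ℕ) : ℤ) + 1) =
      shiftedPow x b M := by
    refine Finset.prod_congr rfl fun j _ => ?_
    have e : -(d : ℤ) + ((d + j : ℕ) : ℤ) + 1 = (j : ℤ) + 1 := by push_cast; ring
    rw [e]
    rfl
  have e3 : shiftedPow y (dualSeq b) d = ∏ j ∈ range d, (1 + b (-(j : ℤ)) * y) := by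
    refine Finset.prod_congr rfl fun j _ => ?_
    simp [dualSeq]
  have n1 : ∏ j ∈ range d, (1 - b (-(j : ℤ)) * x) ≠ 0 := Finset.prod_ne_zero_iff.2 fun j _ => hx _
  have n2 : ∏ j ∈ range d, (1 + b (-(j : ℤ)) * y) ≠ 0 := Finset.prod_ne_zero_iff.2 fun j _ => hy _
  have n3 : shiftedPow x b M ≠ 0 := Finset.prod_ne_zero_iff.2 fun j _ => hx _
  rw [e1, e2, e3]
  generalize ∏ j ∈ range d, (1 - b (-(j : ℤ)) * x) = X at n1 ⊢
  generalize ∏ j ∈ range d, (1 + b (-(j : ℤ)) * y) = Y at n2 ⊢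
  field_simp

/-- The same argument for the `e` holes left by cutting the row at `M = e`. A row without holes has
weights `1 + b_k y`, so now the two normalizations differ in the columns `1, …, e`. -/
theorem coeffA_eq_minor_transpose (a b : ℤ → K) (x y : K) (hx : ∀ k, 1 - b k * x ≠ 0)
    (hy : ∀ k, 1 + b k * y ≠ 0) {mu lam : YoungDiagram} {e : ℕ} (hmu : mu.rowLen 0 ≤ e)
    (hlam : lam.rowLen 0 ≤ e) :
    (∏ j ∈ range e, (1 - b ((j : ℤ) + 1) * x) / (1 + b ((j : ℤ) + 1) * y)) *
      coeffA a b x y mu lam =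
        minor (rowWeights a b x y).reflect.kernel e mu.transpose lam.transpose := by
  set N := max (mu.colLen 0) (lam.colLen 0) with hN
  have hneg : -(-(N : ℤ) + ((N + e : ℕ) : ℤ)) = -(e : ℤ) := by push_cast; ring
  have hrefl := congrFun (congrFun ((rowWeights a b x y).monodromy_reflect (maya mu) (maya lam)
    (-(N : ℤ)) (N + e)) false) false
  simp only [← maya_transpose] at hrefl
  rw [hneg, Matrix.transpose_apply, add_comm N e,
    ((rowWeights a b x y).reflect.monodromy_eq_det_aux (fun k => hy _)
      (fun k => by simp only [rowWeights, RowWeights.reflect]; ring)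
      (maya mu.transpose) (maya lam.transpose) (-(e : ℤ)) (e + N)).1 e _ _
      (enumerates_maya (by simpa using hmu) (by simp [hN]))
      (enumerates_maya (by simpa using hlam) (by simp [hN])), ← minor] at hrefl
  rw [← normRowCoeff_eq_coeffA a b x y hx hy mu lam N e le_rfl (max_le hmu hlam), normRowCoeff,
    rowCoeff, monodromy_eq, add_comm N e, ← hrefl, Finset.prod_range_add, Finset.prod_div_distrib]
  have e1 : ∏ k ∈ range e, (rowWeights a b x y).reflect.a1 (-(e : ℤ) + k + 1) =
      ∏ j ∈ range e, (1 + b ((j : ℤ) + 1) * y) := by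
    rw [← Finset.prod_range_reflect]
    refine Finset.prod_congr rfl fun j hj => ?_
    have := Finset.mem_range.1 hj
    have e' : 1 - (-(e : ℤ) + ((e - 1 - j : ℕ) : ℤ) + 1) = (j : ℤ) + 1 := by omega
    simp only [RowWeights.reflect, rowWeights, e']
  have e2 : ∏ k ∈ range N, (rowWeights a b x y).reflect.a1 (-(e : ℤ) + ((e + k : ℕ) : ℤ) + 1) =
      shiftedPow y (dualSeq b) N := by
    refine Finset.prod_congr rfl fun j _ => ?_
    have e' : 1 - (-(e : ℤ) + ((e + j : ℕ) : ℤ) + 1) = 1 - ((j : ℤ) + 1) := by push_cast; ring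
    simp only [RowWeights.reflect, rowWeights, e', dualSeq]
    ring
  have n1 : ∏ j ∈ range e, (1 + b ((j : ℤ) + 1) * y) ≠ 0 :=
    Finset.prod_ne_zero_iff.2 fun j _ => hy _
  have n2 : shiftedPow x b e ≠ 0 := Finset.prod_ne_zero_iff.2 fun j _ => hx _
  have n3 : shiftedPow y (dualSeq b) N ≠ 0 := by
    rw [← e2]
    exact Finset.prod_ne_zero_iff.2 fun j _ => hy _
  rw [e1, e2, ← shiftedPow]
  generalize ∏ j ∈ range e, (1 + b ((j : ℤ) + 1) * y) = Y at n1 ⊢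
  field_simp

/-! ### Several rows -/

open Classical in
theorem schur_zero (a b : ℤ → K) (x y : Fin 0 → K) (lam mu : YoungDiagram) :
    schur a b x y lam mu = if mu = lam then 1 else 0 := by
  simp [schur, Finsupp.single_apply, eq_comm (a := mu)]

/-- The finite set `T` is left free so that it can be matched with the one that Cauchy–Binet
provides. -/
theorem schur_succ (a b : ℤ → K) {n : ℕ} (x y : Fin (n + 1) → K) (lam mu : YoungDiagram)
    (T : Finset YoungDiagram)
    (hT : ∀ nu, schur a b (fun i => x i.succ) (fun i => y i.succ) lam nu ≠ 0 → nu ∈ T) :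
    schur a b x y lam mu = ∑ nu ∈ T, coeffA a b (x 0) (y 0) mu nu *
      schur a b (fun i => x i.succ) (fun i => y i.succ) lam nu := by
  rw [schur, List.ofFn_succ, List.prod_cons, Module.End.mul_apply]
  set u := (List.ofFn fun i : Fin n => opA a b (x i.succ) (y i.succ)).prod (Finsupp.single lam 1)
    with hu
  have hsup : u.support ⊆ T := fun nu hnu => hT nu (Finsupp.mem_support_iff.1 hnu)
  rw [opA, Finsupp.linearCombination_apply, Finsupp.sum_of_support_subset u hsup _ (by simp),
    Finsupp.finsetSum_apply]
  refine Finset.sum_congr rfl fun nu _ => ?_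
  rw [Finsupp.smul_apply, smul_eq_mul, mul_comm]
  rfl

theorem le_of_schur_ne_zero (a b : ℤ → K) {n : ℕ} (x y : Fin n → K) (lam mu : YoungDiagram)
    (h : schur a b x y lam mu ≠ 0) : mu ≤ lam := by
  induction n generalizing mu with
  | zero =>
    rw [schur_zero] at h
    by_contra hne
    exact h (if_neg fun e => hne e.le)
  | succ n ih =>
    set u := (List.ofFn fun i : Fin n => opA a b (x i.succ) (y i.succ)).prod (Finsupp.single lam 1)
      with hu
    rw [schur_succ a b x y lam mu u.support fun nu hnu => Finsupp.mem_support_iff.2 hnu] at h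
    obtain ⟨nu, -, hnu⟩ := Finset.exists_ne_zero_of_sum_ne_zero h
    exact (le_of_coeffA_ne_zero (left_ne_zero_of_mul hnu)).trans
      (ih _ _ nu (right_ne_zero_of_mul hnu))

/-- If every row is given by minors, then so is the product of the rows. -/
theorem prod_mul_schur_eq_minor (a b : ℤ → K) (d : ℕ) (phi : YoungDiagram ≃o YoungDiagram) {n : ℕ}
    (x y : Fin n → K) (c : Fin n → K) (G : Fin n → IncidenceAlgebra K ℤ)
    (h : ∀ i mu nu, (phi mu).colLen 0 ≤ d → (phi nu).colLen 0 ≤ d →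
      c i * coeffA a b (x i) (y i) mu nu = minor (G i) d (phi mu) (phi nu))
    (mu lam : YoungDiagram) (hmu : (phi mu).colLen 0 ≤ d) (hlam : (phi lam).colLen 0 ≤ d) :
    (∏ i, c i) * schur a b x y lam mu = minor (List.ofFn G).prod d (phi mu) (phi lam) := by
  classical
  induction n generalizing mu with
  | zero =>
    rw [schur_zero, List.ofFn_zero, List.prod_nil, minor_one d hmu hlam]
    simp
  | succ n ih =>
    -- Here `phi` stands for the identity (particles) or for transposition (holes); the set from
    -- Cauchy–Binet is pulled back along it.
    obtain ⟨T, hT1, hT2, hT⟩ := minor_mul (G 0) (List.ofFn fun i : Fin n => G i.succ).prod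
      (mu := phi mu) (lam := phi lam)
    rw [List.ofFn_succ, List.prod_cons, hT, Fin.prod_univ_succ,
      schur_succ a b x y lam mu (T.map phi.symm.toEquiv.toEmbedding), Finset.sum_map,
      Finset.mul_sum]
    · refine Finset.sum_congr rfl fun nu hnu => ?_
      have e : phi (phi.symm nu) = nu := phi.apply_symm_apply nu
      have h1 := h 0 mu (phi.symm nu) hmu (by rw [e]; exact hT2 nu hnu)
      have h2 := ih (fun i => x i.succ) (fun i => y i.succ) (fun i => c i.succ)
        (fun i => G i.succ) (fun i => h i.succ) (phi.symm nu) (by rw [e]; exact hT2 nu hnu)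
      rw [e] at h1 h2
      rw [← h1, ← h2]
      simp only [Equiv.coe_toEmbedding, OrderIso.coe_toEquiv]
      ring
    · intro nu hnu
      have hle := phi.monotone (le_of_schur_ne_zero a b _ _ lam nu hnu)
      refine Finset.mem_map.2 ⟨phi nu, hT1 _ hle ((colLen_le_of_le hle 0).trans hlam), ?_⟩
      simp

/-! ### Kernels of several rows and their translations -/

/-- The one particle amplitudes of several rows. -/
def rowKernel (a b : ℤ → K) {n : ℕ} (x y : Fin n → K) : IncidenceAlgebra K ℤ :=
  (List.ofFn fun i => (rowWeights a b (x i) (y i)).kernel).prod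

/-- The one hole amplitudes of several rows. -/
def colKernel (a b : ℤ → K) {n : ℕ} (x y : Fin n → K) : IncidenceAlgebra K ℤ :=
  (List.ofFn fun i => (rowWeights a b (x i) (y i)).reflect.kernel).prod

theorem kernel_translate (W W' : RowWeights K) (r : ℤ) (ha1 : ∀ k, W'.a1 k = W.a1 (k + r))
    (hb1 : ∀ k, W'.b1 k = W.b1 (k + r)) (hb2 : ∀ k, W'.b2 k = W.b2 (k + r))
    (hc1 : ∀ k, W'.c1 k = W.c1 (k + r)) (hc2 : ∀ k, W'.c2 k = W.c2 (k + r)) (i j : ℤ) :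
    W'.kernel i j = W.kernel (i + r) (j + r) := by
  have hprod : ∏ k ∈ Ioo i j, W'.b2 k / W'.a1 k =
      ∏ k ∈ Ioo (i + r) (j + r), W.b2 k / W.a1 k := by
    rw [← Finset.map_add_right_Ioo, Finset.prod_map]
    exact Finset.prod_congr rfl fun k _ => by rw [hb2, ha1]; rfl
  simp only [RowWeights.kernel_apply, RowWeights.edge, hprod]
  simp only [ha1, hb1, hc1, hc2,
    add_left_inj, add_lt_add_iff_right]

theorem prod_translate {n : ℕ} (G G' : Fin n → IncidenceAlgebra K ℤ) (r : ℤ)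
    (h : ∀ m i j, G' m i j = G m (i + r) (j + r)) (i j : ℤ) :
    (List.ofFn G').prod i j = (List.ofFn G).prod (i + r) (j + r) := by
  induction n generalizing i j with
  | zero => simp
  | succ n ih =>
    rw [List.ofFn_succ, List.prod_cons, List.ofFn_succ, List.prod_cons,
      IncidenceAlgebra.mul_apply, IncidenceAlgebra.mul_apply, ← Finset.map_add_right_Icc,
      Finset.sum_map]
    refine Finset.sum_congr rfl fun k _ => ?_
    rw [h, ih (fun m => G m.succ) _ fun m => h m.succ]
    rfl

theorem rowKernel_shift (a b : ℤ → K) {n : ℕ} (x y : Fin n → K) (r i j : ℤ) :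
    rowKernel (shift r a) (shift r b) x y i j = rowKernel a b x y (i + r) (j + r) :=
  prod_translate _ _ r (fun m i j => kernel_translate (rowWeights a b (x m) (y m))
    (rowWeights (shift r a) (shift r b) (x m) (y m)) r (fun _ => rfl) (fun _ => rfl)
    (fun _ => rfl) (fun _ => rfl) (fun _ => rfl) i j) i j

/-- The reflection `k ↦ 1 - k` reverses translations, hence the opposite sign compared with
`rowKernel_shift`. -/
theorem colKernel_shift (a b : ℤ → K) {n : ℕ} (x y : Fin n → K) (r i j : ℤ) :
    colKernel (shift r a) (shift r b) x y i j = colKernel a b x y (i - r) (j - r) := by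
  have e : ∀ k : ℤ, 1 - (k + -r) = 1 - k + r := fun k => by ring
  rw [sub_eq_add_neg, sub_eq_add_neg]
  refine prod_translate _ _ (-r) (fun m i j => kernel_translate
    (rowWeights a b (x m) (y m)).reflect (rowWeights (shift r a) (shift r b) (x m) (y m)).reflect
    (-r) ?_ ?_ ?_ ?_ ?_ i j) i j <;>
  · intro k
    simp only [RowWeights.reflect, rowWeights, shift, e]

theorem prod_self {n : ℕ} (G : Fin n → IncidenceAlgebra K ℤ) (i : ℤ) :
    (List.ofFn G).prod i i = ∏ m, G m i i := by
  induction n with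
  | zero => simp
  | succ n ih =>
    rw [List.ofFn_succ, List.prod_cons, IncidenceAlgebra.mul_apply, Finset.Icc_self,
      Finset.sum_singleton, ih, Fin.prod_univ_succ]

theorem rowKernel_self_ne_zero {a b : ℤ → K} {n : ℕ} {x y : Fin n → K}
    (hx : ∀ (k : ℤ) (i : Fin n), 1 - b k * x i ≠ 0)
    (hy : ∀ (k : ℤ) (i : Fin n), 1 + b k * y i ≠ 0) (p : ℤ) : rowKernel a b x y p p ≠ 0 := by
  rw [rowKernel, prod_self]
  refine Finset.prod_ne_zero_iff.2 fun m _ => ?_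
  rw [RowWeights.kernel_self]
  exact div_ne_zero (hy p m) (hx p m)

theorem rowNormSchur_eq_minor {a b : ℤ → K} {n : ℕ} {x y : Fin n → K}
    (hx : ∀ (k : ℤ) (i : Fin n), 1 - b k * x i ≠ 0)
    (hy : ∀ (k : ℤ) (i : Fin n), 1 + b k * y i ≠ 0) {d : ℕ} {mu lam : YoungDiagram}
    (hmu : mu.colLen 0 ≤ d) (hlam : lam.colLen 0 ≤ d) :
    rowNormSchur d a b x y lam mu = minor (rowKernel a b x y) d mu lam :=
  prod_mul_schur_eq_minor a b d (OrderIso.refl _) x y _ _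
    (fun i _ _ h1 h2 => coeffA_eq_minor a b (x i) (y i) (fun k => hx k i) (fun k => hy k i) h1 h2)
    mu lam hmu hlam

theorem colNormSchur_eq_minor {a b : ℤ → K} {n : ℕ} {x y : Fin n → K}
    (hx : ∀ (k : ℤ) (i : Fin n), 1 - b k * x i ≠ 0)
    (hy : ∀ (k : ℤ) (i : Fin n), 1 + b k * y i ≠ 0) {e : ℕ} {mu lam : YoungDiagram}
    (hmu : mu.rowLen 0 ≤ e) (hlam : lam.rowLen 0 ≤ e) :
    colNormSchur e a b x y lam mu =
      minor (colKernel a b x y) e mu.transpose lam.transpose := by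
  have h0 : ∀ nu : YoungDiagram, (YoungDiagram.transposeOrderIso nu).colLen 0 = nu.rowLen 0 :=
    fun nu => nu.colLen_transpose 0
  exact prod_mul_schur_eq_minor a b e YoungDiagram.transposeOrderIso x y _ _
    (fun i mu nu h1 h2 => coeffA_eq_minor_transpose a b (x i) (y i) (fun k => hx k i)
      (fun k => hy k i) (by rwa [h0] at h1) (by rwa [h0] at h2))
    mu lam (by rwa [h0]) (by rwa [h0])

/-! ### Diagrams with one row or one column -/

theorem rowLen_eq_of_forall {lam : YoungDiagram} {i m : ℕ} (h : ∀ k, (i, k) ∈ lam ↔ k < m) :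
    lam.rowLen i = m := by
  apply le_antisymm
  · by_contra hlt
    have := (h _).1 (YoungDiagram.mem_iff_lt_rowLen.2 (not_le.1 hlt))
    omega
  · by_contra hlt
    have := YoungDiagram.mem_iff_lt_rowLen.1 ((h _).2 (not_le.1 hlt))
    omega

theorem mem_rowDiagram {k r c : ℕ} : (r, c) ∈ rowDiagram k ↔ r = 0 ∧ c < k := by
  rw [← YoungDiagram.mem_cells]
  simp [rowDiagram]
  omega

theorem mem_colDiagram {k r c : ℕ} : (r, c) ∈ colDiagram k ↔ c = 0 ∧ r < k := by
  rw [colDiagram, YoungDiagram.mem_transpose]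
  exact mem_rowDiagram

theorem rowLen_rowDiagram (k : ℕ) : (rowDiagram k).rowLen 0 = k :=
  rowLen_eq_of_forall fun c => by simp [mem_rowDiagram]

theorem colLen_rowDiagram_le (k : ℕ) : (rowDiagram k).colLen 0 ≤ 1 := by
  by_contra hlt
  have := mem_rowDiagram.1 (YoungDiagram.mem_iff_lt_colLen.2 (not_le.1 hlt))
  omega

theorem rowLen_bot (i : ℕ) : (⊥ : YoungDiagram).rowLen i = 0 :=
  rowLen_eq_of_forall fun k => by simp

theorem transpose_bot : (⊥ : YoungDiagram).transpose = ⊥ := by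
  apply YoungDiagram.ext
  ext c
  simp

theorem colLen_bot (i : ℕ) : (⊥ : YoungDiagram).colLen i = 0 := by
  rw [← YoungDiagram.rowLen_transpose, transpose_bot, rowLen_bot]

theorem pos_bot (i : ℕ) : pos ⊥ i = -(i : ℤ) := by
  simp [pos, rowLen_bot]

theorem minor_bot_rowDiagram (G : IncidenceAlgebra K ℤ) (k : ℕ) :
    minor G 1 ⊥ (rowDiagram k) = G 0 k := by
  rw [minor, Matrix.det_fin_one, Matrix.of_apply, pos_bot, pos]
  simp [rowLen_rowDiagram]

/-! ### The Jacobi–Trudi and Nägelsbach–Kostka formulas -/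

section Parameters

variable {a b : ℤ → K} {n : ℕ} {x y : Fin n → K}

/-- With one particle the minor is a single entry, starting from the vacuum position 0. The
convention for `k < 0` agrees with triangularity. -/
theorem rowH_eq (hx : ∀ (k : ℤ) (i : Fin n), 1 - b k * x i ≠ 0)
    (hy : ∀ (k : ℤ) (i : Fin n), 1 + b k * y i ≠ 0) (k : ℤ) :
    rowH a b x y k = rowKernel a b x y 0 k := by
  rw [rowH]
  split_ifs with hk
  · rw [rowNormSchur_eq_minor hx hy (by simp [colLen_bot]) (colLen_rowDiagram_le _),
      minor_bot_rowDiagram, Int.toNat_of_nonneg hk]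
  · rw [IncidenceAlgebra.apply_eq_zero_of_not_le hk]

theorem colE_eq (hx : ∀ (k : ℤ) (i : Fin n), 1 - b k * x i ≠ 0)
    (hy : ∀ (k : ℤ) (i : Fin n), 1 + b k * y i ≠ 0) (k : ℤ) :
    colE a b x y k = colKernel a b x y 0 k := by
  rw [colE]
  split_ifs with hk
  · rw [colNormSchur_eq_minor hx hy (by simp [rowLen_bot])
        (by simpa [colDiagram] using colLen_rowDiagram_le _),
      transpose_bot, colDiagram, YoungDiagram.transpose_transpose,
      minor_bot_rowDiagram, Int.toNat_of_nonneg hk]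
  · rw [IncidenceAlgebra.apply_eq_zero_of_not_le hk]

/-- The Jacobi–Trudi formula. -/
theorem jacobiTrudi (hx : ∀ (k : ℤ) (i : Fin n), 1 - b k * x i ≠ 0)
    (hy : ∀ (k : ℤ) (i : Fin n), 1 + b k * y i ≠ 0) {mu lam : YoungDiagram} (hle : mu ≤ lam)
    {d : ℕ} (hd : lam.colLen 0 ≤ d) :
    rowNormSchur d a b x y lam mu = Matrix.det (Matrix.of fun i j : Fin d =>
      rowH (shift ((mu.rowLen j : ℤ) - (j : ℕ)) a) (shift ((mu.rowLen j : ℤ) - (j : ℕ)) b) x y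
        ((lam.rowLen i : ℤ) - (mu.rowLen j : ℤ) - (i : ℕ) + (j : ℕ))) := by
  rw [rowNormSchur_eq_minor hx hy ((colLen_le_of_le hle 0).trans hd) hd, minor,
    ← Matrix.det_transpose]
  congr 1
  ext i j
  -- Shifting by the position of row `j` of `mu` moves the starting point of the kernel entry to 0.
  rw [Matrix.transpose_apply, Matrix.of_apply, Matrix.of_apply,
    rowH_eq (b := shift _ b) (fun k m => hx _ m) (fun k m => hy _ m), rowKernel_shift, pos, pos]
  ring_nf

/-- The Nägelsbach–Kostka formula. -/
theorem nagelsbachKostka (hx : ∀ (k : ℤ) (i : Fin n), 1 - b k * x i ≠ 0)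
    (hy : ∀ (k : ℤ) (i : Fin n), 1 + b k * y i ≠ 0) {mu lam : YoungDiagram} (hle : mu ≤ lam)
    {e : ℕ} (he : lam.rowLen 0 ≤ e) :
    colNormSchur e a b x y lam mu = Matrix.det (Matrix.of fun i j : Fin e =>
      colE (shift (-(mu.colLen j : ℤ) + (j : ℕ)) a) (shift (-(mu.colLen j : ℤ) + (j : ℕ)) b) x y
        ((lam.colLen i : ℤ) - (mu.colLen j : ℤ) - (i : ℕ) + (j : ℕ))) := by
  rw [colNormSchur_eq_minor hx hy ((rowLen_le_of_le hle 0).trans he) he, minor,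
    ← Matrix.det_transpose]
  congr 1
  ext i j
  rw [Matrix.transpose_apply, Matrix.of_apply, Matrix.of_apply,
    colE_eq (b := shift _ b) (fun k m => hx _ m) (fun k m => hy _ m), colKernel_shift, pos, pos,
    YoungDiagram.rowLen_transpose, YoungDiagram.rowLen_transpose]
  ring_nf

theorem schur_bot_bot (hx : ∀ (k : ℤ) (i : Fin n), 1 - b k * x i ≠ 0)
    (hy : ∀ (k : ℤ) (i : Fin n), 1 + b k * y i ≠ 0) : schur a b x y ⊥ ⊥ = 1 := by
  have := rowNormSchur_eq_minor (a := a) hx hy (d := 0) (mu := ⊥) (lam := ⊥)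
    (by simp [colLen_bot]) (by simp [colLen_bot])
  simpa [rowNormSchur, minor] using this

theorem colE_eq_mul_schurE (a b : ℤ → K) (x y : Fin n → K) (k : ℤ) :
    colE a b x y k = (∏ i, ∏ j ∈ range 1, (1 - b ((j : ℤ) + 1) * x i) / (1 + b ((j : ℤ) + 1) * y i)) *
      schurE a b x y k := by
  rw [colE, schurE]
  split_ifs
  · rfl
  · rw [mul_zero]

/-- The quotient of `colE` and `schurE` depends only on the shift, that is, on the matrix column
`j`. The same product of quotients therefore comes out of the determinants for `lam/mu` and `mu/mu`,
and the latter identifies it with the column normalized function of `mu/mu`. -/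
theorem schur_eq_mul_det_schurE (hx : ∀ (k : ℤ) (i : Fin n), 1 - b k * x i ≠ 0)
    (hy : ∀ (k : ℤ) (i : Fin n), 1 + b k * y i ≠ 0) {mu lam : YoungDiagram} (hle : mu ≤ lam)
    {e : ℕ} (he : lam.rowLen 0 ≤ e) :
    schur a b x y lam mu = schur a b x y mu mu * Matrix.det (Matrix.of fun i j : Fin e =>
      schurE (shift (-(mu.colLen j : ℤ) + (j : ℕ)) a) (shift (-(mu.colLen j : ℤ) + (j : ℕ)) b) x y
        ((lam.colLen i : ℤ) - (mu.colLen j : ℤ) - (i : ℕ) + (j : ℕ))) := by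
  have h1 := nagelsbachKostka (a := a) hx hy hle he
  have h2 := nagelsbachKostka (a := a) hx hy (le_refl mu) ((rowLen_le_of_le hle 0).trans he)
  -- For `mu/mu` the matrix is unitriangular: index 0 on the diagonal and negative indices below it.
  have h3 : Matrix.det (Matrix.of fun i j : Fin e =>
      schurE (shift (-(mu.colLen j : ℤ) + (j : ℕ)) a) (shift (-(mu.colLen j : ℤ) + (j : ℕ)) b) x y
        ((mu.colLen i : ℤ) - (mu.colLen j : ℤ) - (i : ℕ) + (j : ℕ))) = 1 := by
    rw [Matrix.det_of_isUpperTriangular]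
    · refine Finset.prod_eq_one fun i _ => ?_
      have e0 : (mu.colLen i : ℤ) - (mu.colLen i : ℤ) - (i : ℕ) + (i : ℕ) = 0 := by ring
      rw [Matrix.of_apply, e0, schurE, if_pos le_rfl]
      have : colDiagram (0 : ℤ).toNat = ⊥ := by
        apply YoungDiagram.ext
        ext ⟨r, c⟩
        simp [mem_colDiagram]
      rw [this]
      exact schur_bot_bot (b := shift _ b) (fun k m => hx _ m) (fun k m => hy _ m)
    · intro i j hij
      have hij' : j < i := hij
      have := mu.colLen_anti j i hij'.le
      rw [Matrix.of_apply, schurE, if_neg]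
      have : (j : ℕ) < i := hij'
      omega
  simp only [colE_eq_mul_schurE] at h1 h2
  set f : Fin e → K := fun j => ∏ i, ∏ m ∈ range 1,
    (1 - shift (-(mu.colLen j : ℤ) + (j : ℕ)) b ((m : ℤ) + 1) * x i) /
      (1 + shift (-(mu.colLen j : ℤ) + (j : ℕ)) b ((m : ℤ) + 1) * y i) with hf
  replace h1 := h1.trans (Matrix.det_mul_row f (Matrix.of fun i j : Fin e =>
    schurE (shift (-(mu.colLen j : ℤ) + (j : ℕ)) a) (shift (-(mu.colLen j : ℤ) + (j : ℕ)) b) x y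
      ((lam.colLen i : ℤ) - (mu.colLen j : ℤ) - (i : ℕ) + (j : ℕ))))
  replace h2 := h2.trans (Matrix.det_mul_row f (Matrix.of fun i j : Fin e =>
    schurE (shift (-(mu.colLen j : ℤ) + (j : ℕ)) a) (shift (-(mu.colLen j : ℤ) + (j : ℕ)) b) x y
      ((mu.colLen i : ℤ) - (mu.colLen j : ℤ) - (i : ℕ) + (j : ℕ))))
  rw [h3, mul_one] at h2
  rw [← h2, colNormSchur, colNormSchur, mul_assoc] at h1
  refine mul_left_cancel₀ ?_ h1
  exact Finset.prod_ne_zero_iff.2 fun i _ => Finset.prod_ne_zero_iff.2 fun j _ =>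
    div_ne_zero (hx _ _) (hy _ _)

/-- Up to the normalizing factor this is a product of diagonal entries of the kernel, themselves
products of the quotients `(1 + b_k y_i) / (1 - b_k x_i)`. -/
theorem schur_self_ne_zero (hx : ∀ (k : ℤ) (i : Fin n), 1 - b k * x i ≠ 0)
    (hy : ∀ (k : ℤ) (i : Fin n), 1 + b k * y i ≠ 0) (kappa : YoungDiagram) :
    schur a b x y kappa kappa ≠ 0 := by
  have h := rowNormSchur_eq_minor (a := a) hx hy (le_refl (kappa.colLen 0)) le_rfl
  rw [minor_self] at h
  refine right_ne_zero_of_mul (a := ∏ i, ∏ j ∈ range (kappa.colLen 0),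
    (1 + b (-(j : ℤ)) * y i) / (1 - b (-(j : ℤ)) * x i)) ?_
  rw [← rowNormSchur, h]
  exact Finset.prod_ne_zero_iff.2 fun _ _ => rowKernel_self_ne_zero hx hy _

end Parameters

/-! ### Frobenius coordinates -/

theorem lt_rowLen_of_lt_diagLen {lam : YoungDiagram} {i : ℕ} (h : i < diagLen lam) :
    i < lam.rowLen i :=
  YoungDiagram.mem_iff_lt_rowLen.1 ((mem_diag_iff lam i).2 h)

theorem lt_colLen_of_lt_diagLen {lam : YoungDiagram} {i : ℕ} (h : i < diagLen lam) :
    i < lam.colLen i :=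
  YoungDiagram.mem_iff_lt_colLen.1 ((mem_diag_iff lam i).2 h)

theorem rowLen_le_of_diagLen_le {lam : YoungDiagram} {i : ℕ} (h : diagLen lam ≤ i) :
    lam.rowLen i ≤ i := by
  by_contra hlt
  have := (mem_diag_iff lam i).1 (YoungDiagram.mem_iff_lt_rowLen.2 (not_le.1 hlt))
  omega

theorem diagLen_le_colLen (lam : YoungDiagram) : diagLen lam ≤ lam.colLen 0 := by
  by_contra hlt
  have h1 := lt_colLen_of_lt_diagLen (not_le.1 hlt)
  have := lam.colLen_anti 0 (lam.colLen 0) (Nat.zero_le _)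
  omega

theorem arm_add_one {lam : YoungDiagram} {i : ℕ} (h : i < diagLen lam) :
    (arm lam i : ℤ) + 1 = pos lam i := by
  have := lt_rowLen_of_lt_diagLen h
  simp only [arm, pos]
  omega

theorem leg_cast {lam : YoungDiagram} {j : ℕ} (h : j < diagLen lam) :
    (leg lam j : ℤ) = lam.colLen j - (j + 1) := by
  have := lt_colLen_of_lt_diagLen h
  simp only [leg]
  omega

theorem leg_lt_colLen {lam : YoungDiagram} {j : ℕ} (h : j < diagLen lam) :
    leg lam j < lam.colLen 0 := by
  have h1 := lt_colLen_of_lt_diagLen h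
  have h2 := lam.colLen_anti 0 j (Nat.zero_le _)
  simp only [leg]
  omega

theorem leg_lt_leg {lam : YoungDiagram} {i j : ℕ} (hij : i < j) (hj : j < diagLen lam) :
    leg lam j < leg lam i := by
  have h1 := lt_colLen_of_lt_diagLen hj
  have h2 := lam.colLen_anti i j hij.le
  simp only [leg]
  omega

/-- The legs mark holes: `rowLen c + colLen j` is at least `c + j + 2` or at most `c + j`, according
to whether the box `(c, j)` is in `lam`, and equality of positions would need `c + j + 1`. -/
theorem pos_ne_neg_leg {lam : YoungDiagram} {j : ℕ} (hj : j < diagLen lam) (c : ℕ) :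
    pos lam c ≠ -(leg lam j : ℤ) := by
  rw [leg_cast hj, pos]
  by_cases h : (c, j) ∈ lam
  · have h1 := YoungDiagram.mem_iff_lt_rowLen.1 h
    have h2 := YoungDiagram.mem_iff_lt_colLen.1 h
    omega
  · have h1 := mt YoungDiagram.mem_iff_lt_rowLen.2 h
    have h2 := mt YoungDiagram.mem_iff_lt_colLen.2 h
    omega

theorem pos_pos {lam : YoungDiagram} {i : ℕ} (hi : i < diagLen lam) : 0 < pos lam i := by
  have := arm_add_one hi
  omega

theorem mem_hookDiagram {p q r c : ℕ} :
    (r, c) ∈ hookDiagram p q ↔ (r = 0 ∧ c < p + 1) ∨ (c = 0 ∧ r < q + 1) := by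
  rw [hookDiagram, YoungDiagram.mem_sup, mem_rowDiagram, mem_colDiagram]

theorem colLen_hookDiagram_le (p q : ℕ) : (hookDiagram p q).colLen 0 ≤ q + 1 := by
  by_contra hlt
  have := mem_hookDiagram.1 (YoungDiagram.mem_iff_lt_colLen.2 (not_le.1 hlt))
  omega

/-- A hook is the vacuum `0, -1, -2, …` with the particle at `-q` moved to `p + 1`. -/
theorem pos_hookDiagram (p q c : ℕ) : pos (hookDiagram p q) c =
    if c = 0 then (p : ℤ) + 1 else if c ≤ q then 1 - (c : ℤ) else -(c : ℤ) := by
  split_ifs with h1 h2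
  · have : (hookDiagram p q).rowLen c = p + 1 :=
      rowLen_eq_of_forall fun k => by rw [mem_hookDiagram]; omega
    rw [pos, this]
    push_cast
    omega
  · have : (hookDiagram p q).rowLen c = 1 :=
      rowLen_eq_of_forall fun k => by rw [mem_hookDiagram]; omega
    rw [pos, this]
    omega
  · have : (hookDiagram p q).rowLen c = 0 :=
      rowLen_eq_of_forall fun k => by rw [mem_hookDiagram]; omega
    rw [pos, this]
    omega

theorem mem_ribbonCore {lam : YoungDiagram} {i j r c : ℕ} : (r, c) ∈ ribbonCore lam i j ↔
    (r, c) ∈ lam ∧ (i ≤ r ∧ j ≤ c → (r + 1, c + 1) ∈ lam) := by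
  rw [← YoungDiagram.mem_cells]
  simp [ribbonCore]

theorem ribbonCore_le (lam : YoungDiagram) (i j : ℕ) : ribbonCore lam i j ≤ lam := by
  rw [← YoungDiagram.cells_subset_iff]
  exact Finset.filter_subset _ _

/-- Removing the ribbon cuts each of its rows except the last to one less than the next row, which
gives it the next row's position, and cuts the last to length `j`, at position `-leg lam j`. So
particle `i` jumps into the hole of leg `j` and the particles in between are renumbered. -/
theorem pos_ribbonCore {lam : YoungDiagram} {i j : ℕ} (hj : j < diagLen lam)
    (c : ℕ) : pos (ribbonCore lam i j) c =
      if c < i ∨ lam.colLen j ≤ c then pos lam c else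
        if c + 1 = lam.colLen j then -(leg lam j : ℤ) else pos lam (c + 1) := by
  have hmem : ∀ k, (c, k) ∈ ribbonCore lam i j ↔
      k < lam.rowLen c ∧ (i ≤ c ∧ j ≤ k → k + 1 < lam.rowLen (c + 1)) := fun k => by
    rw [mem_ribbonCore, YoungDiagram.mem_iff_lt_rowLen, YoungDiagram.mem_iff_lt_rowLen]
  have hiff : ∀ c, j < lam.rowLen c ↔ c < lam.colLen j := fun c => by
    rw [← YoungDiagram.mem_iff_lt_rowLen, YoungDiagram.mem_iff_lt_colLen]
  have h0 := hiff c
  have h1 := hiff (c + 1)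
  have h2 := lam.rowLen_anti c (c + 1) (by omega)
  split_ifs with hc hc'
  · have : (ribbonCore lam i j).rowLen c = lam.rowLen c :=
      rowLen_eq_of_forall fun k => by rw [hmem]; omega
    rw [pos, this, pos]
  · have : (ribbonCore lam i j).rowLen c = j :=
      rowLen_eq_of_forall fun k => by rw [hmem]; omega
    rw [pos, this, leg_cast hj]
    omega
  · have : (ribbonCore lam i j).rowLen c = lam.rowLen (c + 1) - 1 :=
      rowLen_eq_of_forall fun k => by rw [hmem]; omega
    rw [pos, this, pos]
    omega

theorem det_of_mul_row {r : ℕ} (v : Fin r → K) (f : Fin r → Fin r → K) :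
    Matrix.det (Matrix.of fun i j => v j * f i j) = (∏ j, v j) * Matrix.det (Matrix.of f) :=
  Matrix.det_mul_row v (Matrix.of f)

theorem det_of_mul_column {r : ℕ} (v : Fin r → K) (f : Fin r → Fin r → K) :
    Matrix.det (Matrix.of fun i j => v i * f i j) = (∏ i, v i) * Matrix.det (Matrix.of f) :=
  Matrix.det_mul_column v (Matrix.of f)

/-! ### Minors for unsorted tuples -/

theorem det_columns_perm (G : IncidenceAlgebra K ℤ) {d : ℕ} (mu nu : YoungDiagram) {J : Fin d → ℤ}
    {σ : Equiv.Perm (Fin d)} (h : J = (fun i : Fin d => pos nu i) ∘ σ) :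
    Matrix.det (Matrix.of fun p q : Fin d => G (pos mu p) (J q)) =
      tupleSign J * minor G d mu nu := by
  have e : (Matrix.of fun p q : Fin d => G (pos mu p) (J q)) =
      (Matrix.of fun p q : Fin d => G (pos mu p) (pos nu q)).submatrix id σ := by
    subst h
    rfl
  rw [e, Matrix.det_permute', sign_eq_tupleSign (pos_fin_strictAnti nu d), ← h, minor]

theorem det_rows_perm (G : IncidenceAlgebra K ℤ) {d : ℕ} (mu nu : YoungDiagram) {J : Fin d → ℤ}
    {σ : Equiv.Perm (Fin d)} (h : J = (fun i : Fin d => pos mu i) ∘ σ) :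
    Matrix.det (Matrix.of fun q p : Fin d => G (J p) (pos nu q)) =
      tupleSign J * minor G d mu nu := by
  have e : (Matrix.of fun q p : Fin d => G (J p) (pos nu q)) =
      ((Matrix.of fun p q : Fin d => G (pos mu p) (pos nu q)).submatrix σ id).transpose := by
    subst h
    rfl
  rw [e, Matrix.det_transpose, Matrix.det_permute, sign_eq_tupleSign (pos_fin_strictAnti mu d),
    ← h, minor]

theorem prod_eq_minor_self (G : IncidenceAlgebra K ℤ) {d : ℕ} (mu : YoungDiagram) {J : Fin d → ℤ}
    {σ : Equiv.Perm (Fin d)} (h : J = (fun i : Fin d => pos mu i) ∘ σ) :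
    ∏ q, G (J q) (J q) = minor G d mu mu := by
  subst h
  rw [minor_self]
  exact Equiv.prod_comp σ fun q : Fin d => G (pos mu q) (pos mu q)

theorem prod_update (g : ℤ → K) {d : ℕ} (X : Fin d → ℤ) (i : Fin d) (z : ℤ) :
    (∏ q, g (Function.update X i z q)) * g (X i) = (∏ q, g (X q)) * g z := by
  have h1 := Finset.mul_prod_erase Finset.univ (fun q => g (Function.update X i z q))
    (Finset.mem_univ i)
  have h2 := Finset.mul_prod_erase Finset.univ (fun q => g (X q)) (Finset.mem_univ i)
  have h3 : ∏ q ∈ Finset.univ.erase i, g (Function.update X i z q) =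
      ∏ q ∈ Finset.univ.erase i, g (X q) :=
    Finset.prod_congr rfl fun q hq => by
      rw [Function.update_of_ne (Finset.ne_of_mem_erase hq)]
  rw [← h1, ← h2, h3]
  simp only [Function.update_self]
  ring

/-- The sign of a tuple all of whose ascents end in the slots in `S`. -/
theorem tupleSign_eq_prod {d : ℕ} {J : Fin d → ℤ} (S : Finset (Fin d))
    (h1 : ∀ p q, p < q → q ∈ S → J p < J q) (h2 : ∀ p q, p < q → q ∉ S → J q ≤ J p) :
    (tupleSign J : K) = ∏ q ∈ S, (-1) ^ (q : ℕ) := by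
  have : (tupleSign J : K) = ∏ q, ∏ p ∈ Iio q, if J p < J q then -1 else 1 := by
    rw [tupleSign]
    exact Finset.prod_comm' (by simp)
  rw [this, ← Finset.prod_subset (Finset.subset_univ S)]
  · refine Finset.prod_congr rfl fun q hq => ?_
    rw [Finset.prod_congr rfl fun p hp => if_pos (h1 p q (Finset.mem_Iio.1 hp) hq)]
    simp
  · intro q _ hq
    exact Finset.prod_eq_one fun p hp => if_neg (not_lt.2 (h2 p q (Finset.mem_Iio.1 hp) hq))

/-! ### The Giambelli formula -/

/-- The reference matrix has the vacuum on both sides. Replacing the column at `-leg lam j` by the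
one at `pos lam i`, which is `arm lam i + 1`, gives a hook; replacing all leg columns gives `lam`.
-/
theorem minor_giambelli (G : IncidenceAlgebra K ℤ) (lam : YoungDiagram)
    (h0 : minor G (lam.colLen 0) ⊥ ⊥ ≠ 0) :
    minor G (lam.colLen 0) ⊥ lam * minor G (lam.colLen 0) ⊥ ⊥ ^ diagLen lam =
      minor G (lam.colLen 0) ⊥ ⊥ *
        Matrix.det (Matrix.of fun i j : Fin (diagLen lam) =>
          minor G (lam.colLen 0) ⊥ (hookDiagram (arm lam i) (leg lam j))) := by
  set d := lam.colLen 0 with hd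
  set r := diagLen lam with hr
  let slot : Fin r → Fin d := fun j => ⟨leg lam j, leg_lt_colLen j.2⟩
  have hslot : StrictAnti slot := fun i j hij => leg_lt_leg hij j.2
  let P0 : Fin d → ℤ := fun q => pos ⊥ q
  have hP0 : ∀ q : Fin d, P0 q = -(q : ℤ) := fun q => pos_bot q
  let J : Fin d → ℤ := Function.extend slot (fun j => pos lam j) P0
  have hJ1 : ∀ j, J (slot j) = pos lam j := fun j => hslot.injective.extend_apply _ _ _
  have hJ2 : ∀ q, q ∉ Set.range slot → J q = -(q : ℤ) := fun q hq => by
    rw [← hP0]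
    exact Function.extend_apply' _ _ _ hq
  let A : Matrix (Fin d) (Fin d) K := Matrix.of fun p q => G (pos ⊥ p) (P0 q)
  let B : Matrix (Fin d) (Fin d) K := Matrix.of fun p q => G (pos ⊥ p) (J q)
  have hA : A.det = minor G d ⊥ ⊥ := rfl
  have key := det_mul_pow_of_columns (A := A) (B := B) h0 hslot.injective fun q hq i => by
    simp only [A, B, Matrix.of_apply, hJ2 q hq, hP0]
  -- the whole replacement
  have hB : B.det = (∏ j, (-1) ^ (slot j : ℕ)) * minor G d ⊥ lam := by
    -- A row below the diagonal part has position `-(c - rowLen c)`, a vacuum position that is not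
    -- the hole of a leg and so was not replaced.
    obtain ⟨σ, hσ⟩ : ∃ σ : Equiv.Perm (Fin d), (fun c : Fin d => pos lam c) = J ∘ σ := by
      refine exists_perm_comp (pos_fin_strictAnti lam d).injective fun c => ?_
      by_cases hc : (c : ℕ) < r
      · exact ⟨slot ⟨c, hc⟩, (hJ1 ⟨c, hc⟩).symm⟩
      · have h1 := rowLen_le_of_diagLen_le (not_lt.1 hc)
        have h2 := c.2
        refine ⟨⟨c - lam.rowLen c, by omega⟩, ?_⟩
        rw [hJ2]
        · simp only [pos]
          omega
        · rintro ⟨j, hj⟩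
          apply pos_ne_neg_leg j.2 c
          have : leg lam j = c - lam.rowLen c := congrArg Fin.val hj
          rw [this, pos]
          omega
    have hσ' : J = (fun c : Fin d => pos lam c) ∘ (σ⁻¹ : Equiv.Perm (Fin d)) := by
      rw [hσ]
      ext q
      simp
    -- Larger slots carry larger positive positions, so each inserted value exceeds everything to
    -- its left and contributes the sign `(-1) ^ leg`.
    rw [det_columns_perm G ⊥ lam hσ', tupleSign_eq_prod (Finset.univ.image slot)]
    · rw [Finset.prod_image fun i _ j _ h => hslot.injective h]
    · intro p q hpq hq
      obtain ⟨j, -, rfl⟩ := Finset.mem_image.1 hq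
      rw [hJ1]
      by_cases hp : p ∈ Set.range slot
      · obtain ⟨i, rfl⟩ := hp
        rw [hJ1]
        exact pos_strictAnti lam (hslot.lt_iff_gt.1 hpq)
      · rw [hJ2 p hp]
        have := pos_pos j.2
        omega
    · intro p q hpq hq
      rw [hJ2 q (by simpa using hq)]
      have hpq' : (p : ℕ) < q := hpq
      by_cases hp : p ∈ Set.range slot
      · obtain ⟨i, rfl⟩ := hp
        rw [hJ1]
        have := pos_pos i.2
        omega
      · rw [hJ2 p hp]
        omega
  -- the single replacements
  have hentry : ∀ i j : Fin r, (A.updateCol (slot j) fun p => B p (slot i)).det =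
      (-1) ^ (slot j : ℕ) * minor G d ⊥ (hookDiagram (arm lam i) (leg lam j)) := by
    intro i j
    set U := Function.update P0 (slot j) (pos lam i) with hU
    have hUs : U (slot j) = pos lam i := Function.update_self _ _ _
    have hUn : ∀ q, q ≠ slot j → U q = -(q : ℤ) := fun q hq => by
      rw [hU, Function.update_of_ne hq, hP0]
    have e : (A.updateCol (slot j) fun p => B p (slot i)) =
        Matrix.of fun p q : Fin d => G (pos ⊥ p) (U q) := by
      ext p q
      rw [Matrix.updateCol_apply, Matrix.of_apply]
      split_ifs with hq
      · rw [hq, hUs]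
        simp only [B, Matrix.of_apply, hJ1]
      · rw [hUn q hq, ← hP0]
        rfl
    obtain ⟨σ, hσ⟩ : ∃ σ : Equiv.Perm (Fin d),
        (fun c : Fin d => pos (hookDiagram (arm lam i) (leg lam j)) c) = U ∘ σ := by
      refine exists_perm_comp (pos_fin_strictAnti _ d).injective fun c => ?_
      rw [pos_hookDiagram]
      have hsj : (slot j : ℕ) = leg lam j := rfl
      have hc := c.2
      split_ifs with h1 h2
      · exact ⟨slot j, by rw [hUs, arm_add_one i.2]⟩
      · refine ⟨⟨c - 1, by omega⟩, ?_⟩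
        rw [hUn _ fun h => by
          have := congrArg Fin.val h
          simp only [hsj] at this
          omega]
        simp only
        omega
      · refine ⟨c, ?_⟩
        rw [hUn _ fun h => by
          have := congrArg Fin.val h
          simp only [hsj] at this
          omega]
    have hσ' : U = (fun c : Fin d => pos (hookDiagram (arm lam i) (leg lam j)) c) ∘
        (σ⁻¹ : Equiv.Perm (Fin d)) := by
      rw [hσ]
      ext q
      simp
    rw [e, det_columns_perm G ⊥ _ hσ', tupleSign_eq_prod {slot j}, Finset.prod_singleton]
    · intro p q hpq hq
      rw [Finset.mem_singleton] at hq
      subst hq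
      rw [hUs, hUn p hpq.ne]
      have := pos_pos i.2
      omega
    · intro p q hpq hq
      rw [Finset.mem_singleton] at hq
      have hpq' : (p : ℕ) < q := hpq
      rw [hUn q hq]
      by_cases hp : p = slot j
      · rw [hp, hUs]
        have := pos_pos i.2
        omega
      · rw [hUn p hp]
        omega
  simp only [hentry] at key
  -- The signs of the single replacements depend only on the column `j`; their product is the sign
  -- of the full replacement.
  rw [hB, hA, det_of_mul_row (fun j => (-1) ^ (slot j : ℕ))
    (fun i j : Fin r => minor G d ⊥ (hookDiagram (arm lam i) (leg lam j)))] at key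
  have hne : (∏ j, (-1 : K) ^ (slot j : ℕ)) ≠ 0 :=
    Finset.prod_ne_zero_iff.2 fun j _ => pow_ne_zero _ (neg_ne_zero.2 one_ne_zero)
  refine mul_left_cancel₀ hne ?_
  linear_combination key

/-! ### The ribbon formula -/

/-- The positions of `lam`, with the particle `i` moved to the hole of the leg `j`. -/
def movedTuple (lam : YoungDiagram) (d i j : ℕ) : Fin d → ℤ :=
  fun q => if (q : ℕ) = i then -(leg lam j : ℤ) else pos lam q

/-- The positions of `lam`, with every particle `i < diagLen lam` moved to the hole of the leg
`i`. -/
def emptiedTuple (lam : YoungDiagram) (d : ℕ) : Fin d → ℤ :=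
  fun q => if (q : ℕ) < diagLen lam then -(leg lam q : ℤ) else pos lam q

theorem movedTuple_eq_update (lam : YoungDiagram) {d : ℕ} (i : Fin d) (j : ℕ) :
    movedTuple lam d i j = Function.update (fun q : Fin d => pos lam q) i (-(leg lam j : ℤ)) := by
  funext q
  rw [Function.update_apply, movedTuple]
  simp only [Fin.ext_iff]

theorem movedTuple_eq_comp (lam : YoungDiagram) {i j : ℕ} (hi : i < diagLen lam)
    (hj : j < diagLen lam) : ∃ σ : Equiv.Perm (Fin (lam.colLen 0)),
      movedTuple lam (lam.colLen 0) i j =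
        (fun c : Fin (lam.colLen 0) => pos (ribbonCore lam i j) c) ∘ σ := by
  have hid : i < lam.colLen 0 := hi.trans_le (diagLen_le_colLen lam)
  have hjd := lam.colLen_anti 0 j (Nat.zero_le _)
  have hij : i < lam.colLen j := by
    have h1 := lt_rowLen_of_lt_diagLen hi
    have h2 := lt_colLen_of_lt_diagLen hj
    rcases le_total i j with h | h
    · omega
    · exact YoungDiagram.mem_iff_lt_colLen.1 (YoungDiagram.mem_iff_lt_rowLen.2 (by omega))
  obtain ⟨σ, hσ⟩ : ∃ σ : Equiv.Perm (Fin (lam.colLen 0)),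
      (fun c : Fin (lam.colLen 0) => pos (ribbonCore lam i j) c) =
        movedTuple lam (lam.colLen 0) i j ∘ σ := by
    refine exists_perm_comp (pos_fin_strictAnti _ _).injective fun c => ?_
    have hc := c.2
    rw [pos_ribbonCore hj]
    split_ifs with h1 h2
    · exact ⟨c, by rw [movedTuple, if_neg (by omega)]⟩
    · exact ⟨⟨i, hid⟩, by rw [movedTuple, if_pos rfl]⟩
    · exact ⟨⟨c + 1, by omega⟩, by rw [movedTuple, if_neg (by simp only; omega)]⟩
  refine ⟨σ⁻¹, ?_⟩
  rw [hσ]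
  ext q
  simp

/-- The legs are distinct holes of `lam` among `0, …, 1 - d`, and the remaining particles already
lie there; `d` distinct values fill this interval. -/
theorem emptiedTuple_eq_comp (lam : YoungDiagram) :
    ∃ σ : Equiv.Perm (Fin (lam.colLen 0)), emptiedTuple lam (lam.colLen 0) =
      (fun c : Fin (lam.colLen 0) => pos ⊥ c) ∘ σ := by
  refine exists_perm_comp (fun p q hpq => ?_) fun q => ?_
  · simp only [emptiedTuple] at hpq
    split_ifs at hpq with h1 h2 h2
    · rcases lt_trichotomy (p : ℕ) q with h | h | h
      · have := leg_lt_leg h h2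
        omega
      · exact Fin.ext h
      · have := leg_lt_leg h h1
        omega
    · exact (pos_ne_neg_leg h1 q hpq.symm).elim
    · exact (pos_ne_neg_leg h2 p hpq).elim
    · exact Fin.ext ((pos_strictAnti lam).injective hpq)
  · have hq := q.2
    simp only [emptiedTuple, pos_bot]
    split_ifs with h
    · exact ⟨⟨leg lam q, leg_lt_colLen h⟩, rfl⟩
    · have := rowLen_le_of_diagLen_le (not_lt.1 h)
      refine ⟨⟨q - lam.rowLen q, by omega⟩, ?_⟩
      simp only [pos]
      omega

/-- The contribution of the first particles to the sign of `movedTuple`. -/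
def headSign (lam : YoungDiagram) (d i : ℕ) : K :=
  ∏ q : Fin d, if i < q ∧ (q : ℕ) < diagLen lam then -1 else 1

/-- The contribution of the last particles to the sign of `movedTuple`. -/
def tailSign (lam : YoungDiagram) (d j : ℕ) : K :=
  ∏ q : Fin d, if diagLen lam ≤ q ∧ -(leg lam j : ℤ) < pos lam q then -1 else 1

/-- The particles jumped over split into the later diagonal ones, which depend only on `i`, and the
lower ones, which depend only on `j`. This factorization lets the signs leave the determinant. -/
theorem headSign_mul_tailSign (lam : YoungDiagram) {d : ℕ} {i : Fin d} {j : ℕ}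
    (hi : (i : ℕ) < diagLen lam) :
    (headSign lam d i * tailSign lam d j : K) = ∏ q ∈ Ioi i,
      if (q : ℕ) < diagLen lam ∨ -(leg lam j : ℤ) < pos lam q then -1 else 1 := by
  rw [headSign, tailSign, ← Finset.prod_mul_distrib,
    ← Finset.prod_subset (Finset.subset_univ (Ioi i))]
  · refine Finset.prod_congr rfl fun q hq => ?_
    have hiq : (i : ℕ) < q := Fin.lt_def.1 (Finset.mem_Ioi.1 hq)
    by_cases h : (q : ℕ) < diagLen lam
    · simp [h, hiq]
    · simp [h, not_lt.1 h]
  · intro q _ hq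
    have hiq : ¬ (i : ℕ) < q := fun h => hq (Finset.mem_Ioi.2 h)
    rw [if_neg (by omega), if_neg (by omega), mul_one]

/-- Only the moved particle is out of order, so all ascents start at slot `i`; the later diagonal
particles are at positive positions and always count. -/
theorem tupleSign_movedTuple (lam : YoungDiagram) {d : ℕ} {i : Fin d} {j : ℕ}
    (hi : (i : ℕ) < diagLen lam) :
    (tupleSign (movedTuple lam d i j) : K) = headSign lam d i * tailSign lam d j := by
  rw [headSign_mul_tailSign lam hi, tupleSign, Finset.prod_eq_single i]
  · refine Finset.prod_congr rfl fun q hq => ?_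
    have hiq : (i : ℕ) < q := Fin.lt_def.1 (Finset.mem_Ioi.1 hq)
    refine if_congr ?_ rfl rfl
    rw [movedTuple, movedTuple, if_pos rfl, if_neg hiq.ne']
    constructor
    · exact Or.inr
    · rintro (h | h)
      · have := pos_pos h
        omega
      · exact h
  · intro p _ hp
    refine Finset.prod_eq_one fun q hq => if_neg ?_
    have hpq : (p : ℕ) < q := Fin.lt_def.1 (Finset.mem_Ioi.1 hq)
    have hp' : (p : ℕ) ≠ i := fun h => hp (Fin.ext h)
    simp only [movedTuple]
    rw [if_neg hp']
    split_ifs with h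
    · have := pos_pos (hpq.trans (h.trans_lt hi))
      have := pos_strictAnti lam hpq
      omega
    · exact not_lt.2 (pos_strictAnti lam hpq).le
  · simp

/-- The legs decrease, so any two moved particles form an ascent. This is the same count as when
each particle `i` is moved alone to the hole of leg `i`. -/
theorem tupleSign_emptiedTuple (lam : YoungDiagram) {d : ℕ} (hd : diagLen lam ≤ d) :
    (tupleSign (emptiedTuple lam d) : K) =
      ∏ i : Fin (diagLen lam), headSign lam d i * tailSign lam d i := by
  have himage : ∏ i : Fin (diagLen lam), (headSign lam d i * tailSign lam d i : K) =
      ∏ p ∈ Finset.univ.image (Fin.castLE hd), headSign lam d p * tailSign lam d p := by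
    rw [Finset.prod_image fun i _ j _ h => Fin.castLE_injective hd h]
    rfl
  have hmem : ∀ p : Fin d, p ∈ Finset.univ.image (Fin.castLE hd) ↔ (p : ℕ) < diagLen lam := by
    intro p
    rw [Finset.mem_image]
    constructor
    · rintro ⟨i, -, rfl⟩
      exact i.2
    · intro h
      exact ⟨⟨p, h⟩, Finset.mem_univ _, rfl⟩
  rw [himage, tupleSign, ← Finset.prod_subset (Finset.subset_univ (Finset.univ.image
    (Fin.castLE hd)))]
  · refine Finset.prod_congr rfl fun p hp => ?_
    rw [hmem] at hp
    rw [headSign_mul_tailSign lam hp]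
    refine Finset.prod_congr rfl fun q hq => ?_
    have hpq : (p : ℕ) < q := Fin.lt_def.1 (Finset.mem_Ioi.1 hq)
    refine if_congr ?_ rfl rfl
    simp only [emptiedTuple, if_pos hp]
    split_ifs with h
    · have := leg_lt_leg hpq h
      simp only [h, true_or, iff_true]
      omega
    · simp only [h, false_or]
  · intro p _ hp
    rw [hmem] at hp
    refine Finset.prod_eq_one fun q hq => if_neg ?_
    have hpq : (p : ℕ) < q := Fin.lt_def.1 (Finset.mem_Ioi.1 hq)
    simp only [emptiedTuple]
    rw [if_neg hp, if_neg (by omega)]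
    exact not_lt.2 (pos_strictAnti lam hpq).le

/-- The reference matrix has `lam` on both sides, transposed so that moving a particle of the upper
boundary replaces a column. One move produces a `ribbonCore`, and moving all diagonal particles
produces the vacuum. -/
theorem minor_ribbon (G : IncidenceAlgebra K ℤ) (lam : YoungDiagram)
    (h0 : minor G (lam.colLen 0) lam lam ≠ 0) :
    minor G (lam.colLen 0) ⊥ lam * minor G (lam.colLen 0) lam lam ^ diagLen lam =
      minor G (lam.colLen 0) lam lam *
        Matrix.det (Matrix.of fun i j : Fin (diagLen lam) =>
          minor G (lam.colLen 0) (ribbonCore lam i j) lam) := by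
  set d := lam.colLen 0 with hd
  set r := diagLen lam with hr
  have hrd : r ≤ d := diagLen_le_colLen lam
  let A : Matrix (Fin d) (Fin d) K := Matrix.of fun p q => G (pos lam q) (pos lam p)
  let B : Matrix (Fin d) (Fin d) K := Matrix.of fun p q => G (emptiedTuple lam d q) (pos lam p)
  have hA : A.det = minor G d lam lam := by
    rw [← Matrix.det_transpose]
    rfl
  have key := det_mul_pow_of_columns (A := A) (B := B) (by rwa [hA]) (Fin.castLE_injective hrd)
    fun q hq i => by
      have : ¬ (q : ℕ) < diagLen lam := fun h => hq ⟨⟨q, h⟩, rfl⟩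
      simp only [A, B, Matrix.of_apply, emptiedTuple, if_neg this]
  have hB : B.det = tupleSign (emptiedTuple lam d) * minor G d ⊥ lam := by
    obtain ⟨σ, hσ⟩ := emptiedTuple_eq_comp lam
    exact det_rows_perm G ⊥ lam hσ
  -- Entry `(i, j)` moves particle `j` to the hole of leg `i`; the exchanged indices are undone by a
  -- transposition below.
  have hentry : ∀ i j : Fin r, (A.updateCol (Fin.castLE hrd j) fun p => B p (Fin.castLE hrd i)).det =
      tailSign lam d i * (headSign lam d j * minor G d (ribbonCore lam j i) lam) := by
    intro i j
    have e : (A.updateCol (Fin.castLE hrd j) fun p => B p (Fin.castLE hrd i)) =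
        Matrix.of fun p q : Fin d => G (movedTuple lam d j i q) (pos lam p) := by
      ext p q
      have hi : ((Fin.castLE hrd i : Fin d) : ℕ) < diagLen lam := i.2
      rw [Matrix.updateCol_apply, Matrix.of_apply, movedTuple]
      simp only [Fin.ext_iff, Fin.val_castLE]
      split_ifs with hq
      · simp only [B, Matrix.of_apply, emptiedTuple]
        rw [if_pos hi, Fin.val_castLE]
      · rfl
    obtain ⟨σ, hσ⟩ := movedTuple_eq_comp lam j.2 i.2
    have hs := tupleSign_movedTuple (K := K) lam (d := d) (i := Fin.castLE hrd j) (j := i) j.2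
    rw [Fin.val_castLE] at hs
    rw [e, det_rows_perm G _ lam hσ, hs]
    ring
  simp only [hentry] at key
  rw [hB, hA, det_of_mul_column (fun i : Fin r => tailSign lam d i)
      (fun i j => headSign lam d j * minor G d (ribbonCore lam j i) lam),
    det_of_mul_row (fun j : Fin r => headSign lam d j)
      (fun i j => minor G d (ribbonCore lam j i) lam),
    ← Matrix.det_transpose (Matrix.of fun i j : Fin r => minor G d (ribbonCore lam j i) lam),
    tupleSign_emptiedTuple lam hrd, Finset.prod_mul_distrib] at key
  have hne : (∏ i : Fin r, headSign lam d i : K) * ∏ i : Fin r, tailSign lam d i ≠ 0 := by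
    rw [← Finset.prod_mul_distrib, ← tupleSign_emptiedTuple lam hrd]
    exact left_ne_zero_of_mul_eq_one (tupleSign_mul_self _)
  refine mul_left_cancel₀ hne ?_
  have e : (Matrix.of fun i j : Fin r => minor G d (ribbonCore lam j i) lam).transpose =
      Matrix.of fun i j : Fin r => minor G d (ribbonCore lam i j) lam := rfl
  rw [e] at key
  linear_combination key

/-! ### The Giambelli and ribbon formulas for the Schur functions -/

section Parameters

variable {a b : ℤ → K} {n : ℕ} {x y : Fin n → K}

/-- The factor of the row normalization. -/
def rowFactor (b : ℤ → K) {n : ℕ} (x y : Fin n → K) (d : ℕ) : K :=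
  ∏ i, ∏ j ∈ range d, (1 + b (-(j : ℤ)) * y i) / (1 - b (-(j : ℤ)) * x i)

theorem rowFactor_ne_zero (hx : ∀ (k : ℤ) (i : Fin n), 1 - b k * x i ≠ 0)
    (hy : ∀ (k : ℤ) (i : Fin n), 1 + b k * y i ≠ 0) (d : ℕ) : rowFactor b x y d ≠ 0 :=
  Finset.prod_ne_zero_iff.2 fun _ _ => Finset.prod_ne_zero_iff.2 fun _ _ =>
    div_ne_zero (hy _ _) (hx _ _)

theorem minor_eq_rowFactor_mul (hx : ∀ (k : ℤ) (i : Fin n), 1 - b k * x i ≠ 0)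
    (hy : ∀ (k : ℤ) (i : Fin n), 1 + b k * y i ≠ 0) {d : ℕ} {mu lam : YoungDiagram}
    (hmu : mu.colLen 0 ≤ d) (hlam : lam.colLen 0 ≤ d) :
    minor (rowKernel a b x y) d mu lam = rowFactor b x y d * schur a b x y lam mu :=
  (rowNormSchur_eq_minor hx hy hmu hlam).symm

theorem colLen_bot_le (d : ℕ) : (⊥ : YoungDiagram).colLen 0 ≤ d := by
  rw [colLen_bot]
  exact Nat.zero_le d

/-- The Giambelli formula. -/
theorem giambelli (hx : ∀ (k : ℤ) (i : Fin n), 1 - b k * x i ≠ 0)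
    (hy : ∀ (k : ℤ) (i : Fin n), 1 + b k * y i ≠ 0) (lam : YoungDiagram) :
    schur a b x y lam ⊥ = Matrix.det (Matrix.of fun i j : Fin (diagLen lam) =>
      schur a b x y (hookDiagram (arm lam i) (leg lam j)) ⊥) := by
  have hP := rowFactor_ne_zero hx hy (lam.colLen 0)
  have h00 : minor (rowKernel a b x y) (lam.colLen 0) ⊥ ⊥ = rowFactor b x y (lam.colLen 0) := by
    rw [minor_eq_rowFactor_mul hx hy (colLen_bot_le _) (colLen_bot_le _), schur_bot_bot hx hy,
      mul_one]
  have key := minor_giambelli (rowKernel a b x y) lam (by rwa [h00])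
  have hhook : ∀ i j : Fin (diagLen lam),
      minor (rowKernel a b x y) (lam.colLen 0) ⊥ (hookDiagram (arm lam i) (leg lam j)) =
        rowFactor b x y (lam.colLen 0) *
          schur a b x y (hookDiagram (arm lam i) (leg lam j)) ⊥ := fun i j =>
    minor_eq_rowFactor_mul hx hy (colLen_bot_le _)
      ((colLen_hookDiagram_le _ _).trans (leg_lt_colLen j.2))
  simp only [hhook] at key
  rw [h00, minor_eq_rowFactor_mul hx hy (colLen_bot_le _) le_rfl,
    det_of_mul_row (fun _ : Fin (diagLen lam) => rowFactor b x y (lam.colLen 0))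
      (fun i j => schur a b x y (hookDiagram (arm lam i) (leg lam j)) ⊥),
    Finset.prod_const, Finset.card_fin] at key
  refine mul_left_cancel₀ (mul_ne_zero hP (pow_ne_zero (diagLen lam) hP)) ?_
  linear_combination key

/-- Both sides of `minor_ribbon` contain `rowFactor` to the power `diagLen lam + 1`, which cancels.
Not dividing by `schur a b x y lam lam` spares a separate treatment of the empty diagram. -/
theorem schur_mul_pow_eq_det (hx : ∀ (k : ℤ) (i : Fin n), 1 - b k * x i ≠ 0)
    (hy : ∀ (k : ℤ) (i : Fin n), 1 + b k * y i ≠ 0) (lam : YoungDiagram) :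
    schur a b x y lam ⊥ * schur a b x y lam lam ^ diagLen lam =
      schur a b x y lam lam * Matrix.det (Matrix.of fun i j : Fin (diagLen lam) =>
        schur a b x y lam (ribbonCore lam i j)) := by
  have hP := rowFactor_ne_zero hx hy (lam.colLen 0)
  have hll := minor_eq_rowFactor_mul (a := a) hx hy (le_refl (lam.colLen 0)) le_rfl
  have key := minor_ribbon (rowKernel a b x y) lam
    (by rw [hll]; exact mul_ne_zero hP (schur_self_ne_zero hx hy lam))
  have hcore : ∀ i j : Fin (diagLen lam),
      minor (rowKernel a b x y) (lam.colLen 0) (ribbonCore lam i j) lam =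
        rowFactor b x y (lam.colLen 0) * schur a b x y lam (ribbonCore lam i j) := fun i j =>
    minor_eq_rowFactor_mul hx hy (colLen_le_of_le (ribbonCore_le lam i j) 0) le_rfl
  simp only [hcore] at key
  rw [hll, minor_eq_rowFactor_mul hx hy (colLen_bot_le _) le_rfl,
    det_of_mul_row (fun _ : Fin (diagLen lam) => rowFactor b x y (lam.colLen 0))
      (fun i j => schur a b x y lam (ribbonCore lam i j)),
    Finset.prod_const, Finset.card_fin, mul_pow] at key
  refine mul_left_cancel₀ (mul_ne_zero hP (pow_ne_zero (diagLen lam) hP)) ?_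
  linear_combination key

/-- The ribbon formula without normalization. -/
theorem ribbon_formula (hx : ∀ (k : ℤ) (i : Fin n), 1 - b k * x i ≠ 0)
    (hy : ∀ (k : ℤ) (i : Fin n), 1 + b k * y i ≠ 0) (lam : YoungDiagram) :
    schur a b x y lam lam ^ ((diagLen lam : ℤ) - 1) * schur a b x y lam ⊥ =
      Matrix.det (Matrix.of fun i j : Fin (diagLen lam) =>
        schur a b x y lam (ribbonCore lam i j)) := by
  have h0 := schur_self_ne_zero (a := a) hx hy lam
  -- The exponent is an integer, equal to `-1` for the empty diagram.
  rw [zpow_sub_one₀ h0, zpow_natCast]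
  refine mul_left_cancel₀ h0 ?_
  rw [← schur_mul_pow_eq_det hx hy lam]
  field_simp

/-- Diagonal minors are products of diagonal kernel entries over the occupied positions, and the two
diagrams differ by a single moved particle. -/
theorem schur_self_ribbonCore (hx : ∀ (k : ℤ) (i : Fin n), 1 - b k * x i ≠ 0)
    (hy : ∀ (k : ℤ) (i : Fin n), 1 + b k * y i ≠ 0) (lam : YoungDiagram) {i j : ℕ}
    (hi : i < diagLen lam) (hj : j < diagLen lam) :
    schur a b x y (ribbonCore lam i j) (ribbonCore lam i j) *
        rowKernel a b x y (pos lam i) (pos lam i) =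
      schur a b x y lam lam *
        rowKernel a b x y (-(leg lam j : ℤ)) (-(leg lam j : ℤ)) := by
  have hcol := colLen_le_of_le (ribbonCore_le lam i j) 0
  obtain ⟨σ, hσ⟩ := movedTuple_eq_comp lam hi hj
  have h1 := prod_eq_minor_self (rowKernel a b x y) (ribbonCore lam i j) hσ
  have h2 := minor_self (rowKernel a b x y) (lam.colLen 0) lam
  have h3 := prod_update (fun p => rowKernel a b x y p p)
    (fun q : Fin (lam.colLen 0) => pos lam q) ⟨i, hi.trans_le (diagLen_le_colLen lam)⟩
    (-(leg lam j : ℤ))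
  rw [← movedTuple_eq_update] at h3
  simp only at h3
  rw [h1, ← h2, minor_eq_rowFactor_mul hx hy hcol hcol,
    minor_eq_rowFactor_mul hx hy le_rfl le_rfl] at h3
  refine mul_left_cancel₀ (rowFactor_ne_zero hx hy (lam.colLen 0)) ?_
  linear_combination h3

/-- The same comparison between `lam` and the vacuum: the particles beyond the diagonal part are
common to both and cancel. -/
theorem prod_rowKernel_pos (hx : ∀ (k : ℤ) (i : Fin n), 1 - b k * x i ≠ 0)
    (hy : ∀ (k : ℤ) (i : Fin n), 1 + b k * y i ≠ 0) (lam : YoungDiagram) :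
    ∏ i : Fin (diagLen lam), rowKernel a b x y (pos lam i) (pos lam i) =
      schur a b x y lam lam *
        ∏ i : Fin (diagLen lam), rowKernel a b x y (-(leg lam i : ℤ)) (-(leg lam i : ℤ)) := by
  obtain ⟨σ, hσ⟩ := emptiedTuple_eq_comp lam
  obtain ⟨m, hm⟩ := Nat.exists_eq_add_of_le (diagLen_le_colLen lam)
  have h1 := prod_eq_minor_self (rowKernel a b x y) ⊥ hσ
  have h2 := minor_self (rowKernel a b x y) (lam.colLen 0) lam
  rw [minor_eq_rowFactor_mul hx hy (colLen_bot_le _) (colLen_bot_le _), schur_bot_bot hx hy,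
    mul_one] at h1
  rw [minor_eq_rowFactor_mul hx hy le_rfl le_rfl] at h2
  set g : ℤ → K := fun p => rowKernel a b x y p p with hg
  have e1 : ∏ q : Fin (lam.colLen 0), g (emptiedTuple lam (lam.colLen 0) q) =
      (∏ i ∈ range (diagLen lam), g (-(leg lam i : ℤ))) *
        ∏ i ∈ range m, g (pos lam (diagLen lam + i)) := by
    rw [← Fin.prod_univ_eq_prod_range (fun i => g (-(leg lam i : ℤ)))]
    have := Fin.prod_univ_eq_prod_range
      (fun q => g (if q < diagLen lam then -(leg lam q : ℤ) else pos lam q)) (lam.colLen 0)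
    refine this.trans ?_
    rw [hm, Finset.prod_range_add, Fin.prod_univ_eq_prod_range (fun i => g (-(leg lam i : ℤ)))]
    congr 1
    · exact Finset.prod_congr rfl fun q hq => by rw [if_pos (Finset.mem_range.1 hq)]
    · exact Finset.prod_congr rfl fun q _ => by rw [if_neg (by omega)]
  have e2 : ∏ q : Fin (lam.colLen 0), g (pos lam q) =
      (∏ i ∈ range (diagLen lam), g (pos lam i)) *
        ∏ i ∈ range m, g (pos lam (diagLen lam + i)) := by
    rw [Fin.prod_univ_eq_prod_range (fun q => g (pos lam q)), hm, Finset.prod_range_add]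
  have hne : ∏ i ∈ range m, g (pos lam (diagLen lam + i)) ≠ 0 :=
    Finset.prod_ne_zero_iff.2 fun _ _ => rowKernel_self_ne_zero hx hy _
  have h1' := e1.symm.trans h1
  have h2' := h2.trans e2
  rw [Fin.prod_univ_eq_prod_range (fun i => g (pos lam i)),
    Fin.prod_univ_eq_prod_range (fun i => g (-(leg lam i : ℤ)))]
  refine mul_right_cancel₀ hne ?_
  rw [← h2', ← h1']
  ring

/-- The ribbon formula. -/
theorem ribbon_formula_normalized (hx : ∀ (k : ℤ) (i : Fin n), 1 - b k * x i ≠ 0)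
    (hy : ∀ (k : ℤ) (i : Fin n), 1 + b k * y i ≠ 0) (lam : YoungDiagram) :
    schur a b x y lam ⊥ = Matrix.det (Matrix.of fun i j : Fin (diagLen lam) =>
      ribbonSchur a b x y lam i j) := by
  have h0 := schur_self_ne_zero (a := a) hx hy lam
  have hg := rowKernel_self_ne_zero (a := a) hx hy
  -- The normalizing denominator is a factor depending on `j` divided by one depending on `i`, so
  -- normalizing just rescales rows and columns.
  have hentry : ∀ i j : Fin (diagLen lam), ribbonSchur a b x y lam i j =
      rowKernel a b x y (pos lam i) (pos lam i) *
        ((schur a b x y lam lam *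
          rowKernel a b x y (-(leg lam j : ℤ)) (-(leg lam j : ℤ)))⁻¹ *
            schur a b x y lam (ribbonCore lam i j)) := by
    intro i j
    have hk := schur_self_ne_zero (a := a) hx hy (ribbonCore lam i j)
    rw [ribbonSchur, ← schur_self_ribbonCore hx hy lam i.2 j.2]
    have := hg (pos lam i)
    field_simp
  have hQ : ∏ j : Fin (diagLen lam),
      rowKernel a b x y (-(leg lam j : ℤ)) (-(leg lam j : ℤ)) ≠ 0 :=
    Finset.prod_ne_zero_iff.2 fun _ _ => hg _
  simp only [hentry]
  -- By `prod_rowKernel_pos` the diagonal kernel entries cancel from the total rescaling, which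
  -- leaves the power `1 - diagLen lam` of `schur a b x y lam lam`.
  rw [det_of_mul_column (fun i : Fin (diagLen lam) => rowKernel a b x y (pos lam i) (pos lam i))
      (fun i j => (schur a b x y lam lam *
          rowKernel a b x y (-(leg lam j : ℤ)) (-(leg lam j : ℤ)))⁻¹ *
            schur a b x y lam (ribbonCore lam i j)),
    det_of_mul_row (fun j : Fin (diagLen lam) => (schur a b x y lam lam *
          rowKernel a b x y (-(leg lam j : ℤ)) (-(leg lam j : ℤ)))⁻¹)
      (fun i j => schur a b x y lam (ribbonCore lam i j)),
    prod_rowKernel_pos hx hy, Finset.prod_inv_distrib, Finset.prod_mul_distrib,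
    Finset.prod_const, Finset.card_fin]
  generalize ∏ j : Fin (diagLen lam),
      rowKernel a b x y (-(leg lam j : ℤ)) (-(leg lam j : ℤ)) = Q at hQ ⊢
  have key := schur_mul_pow_eq_det (a := a) hx hy lam
  have hpow := pow_ne_zero (diagLen lam) h0
  field_simp
  linear_combination key

end Parameters

end FFSchur

end

theorem mainTheorem7 {K : Type*} [Field K] (a b : ℤ → K) (n : ℕ) (x y : Fin n → K)
    (hx : ∀ (k : ℤ) (i : Fin n), 1 - b k * x i ≠ 0)
    (hy : ∀ (k : ℤ) (i : Fin n), 1 + b k * y i ≠ 0)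
    (lam : YoungDiagram) :
    (∀ mu : YoungDiagram, mu ≤ lam → ∀ d : ℕ, lam.colLen 0 ≤ d →
      FFSchur.rowNormSchur d a b x y lam mu =
        Matrix.det (Matrix.of fun i j : Fin d =>
          FFSchur.rowH
            (FFSchur.shift ((mu.rowLen j : ℤ) - (j : ℕ)) a)
            (FFSchur.shift ((mu.rowLen j : ℤ) - (j : ℕ)) b) x y
            ((lam.rowLen i : ℤ) - (mu.rowLen j : ℤ) - (i : ℕ) + (j : ℕ)))) ∧
    (∀ mu : YoungDiagram, mu ≤ lam → ∀ e : ℕ, lam.rowLen 0 ≤ e →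
      FFSchur.colNormSchur e a b x y lam mu =
        Matrix.det (Matrix.of fun i j : Fin e =>
          FFSchur.colE
            (FFSchur.shift (-(mu.colLen j : ℤ) + (j : ℕ)) a)
            (FFSchur.shift (-(mu.colLen j : ℤ) + (j : ℕ)) b) x y
            ((lam.colLen i : ℤ) - (mu.colLen j : ℤ) - (i : ℕ) + (j : ℕ)))) ∧
    (∀ mu : YoungDiagram, mu ≤ lam → ∀ d e : ℕ, lam.colLen 0 ≤ d → lam.rowLen 0 ≤ e →
      FFSchur.rowNormSchur d a b x y lam mu =
        FFSchur.rowNormSchur d a b x y mu mu *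
          Matrix.det (Matrix.of fun i j : Fin e =>
            FFSchur.schurE
              (FFSchur.shift (-(mu.colLen j : ℤ) + (j : ℕ)) a)
              (FFSchur.shift (-(mu.colLen j : ℤ) + (j : ℕ)) b) x y
              ((lam.colLen i : ℤ) - (mu.colLen j : ℤ) - (i : ℕ) + (j : ℕ)))) ∧
    (FFSchur.schur a b x y lam ⊥ =
      Matrix.det (Matrix.of fun i j : Fin (FFSchur.diagLen lam) =>
        FFSchur.schur a b x y
          (FFSchur.hookDiagram (FFSchur.arm lam i) (FFSchur.leg lam j)) ⊥)) ∧
    ((∀ kappa : YoungDiagram, FFSchur.schur a b x y kappa kappa ≠ 0) ∧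
      FFSchur.schur a b x y lam ⊥ =
        Matrix.det (Matrix.of fun i j : Fin (FFSchur.diagLen lam) =>
          FFSchur.ribbonSchur a b x y lam i j) ∧
      FFSchur.schur a b x y lam lam ^ ((FFSchur.diagLen lam : ℤ) - 1) *
          FFSchur.schur a b x y lam ⊥ =
        Matrix.det (Matrix.of fun i j : Fin (FFSchur.diagLen lam) =>
          FFSchur.schur a b x y lam (FFSchur.ribbonCore lam i j))) := by
  refine ⟨fun mu hle d hd => FFSchur.jacobiTrudi hx hy hle hd,
    fun mu hle e he => FFSchur.nagelsbachKostka hx hy hle he, fun mu hle d e _ he => ?_,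
    FFSchur.giambelli hx hy lam, FFSchur.schur_self_ne_zero hx hy,
    FFSchur.ribbon_formula_normalized hx hy lam, FFSchur.ribbon_formula hx hy lam⟩
  rw [FFSchur.rowNormSchur, FFSchur.rowNormSchur, FFSchur.schur_eq_mul_det_schurE hx hy hle he,
    mul_assoc]
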